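/- Let $\mathbb K$ be a field and $R=\mathbb K[x_1,\dots,x_n]$. For a monomial ideal $I\subseteq R$ let $\mathcal G(I)$ be its set of minimal monomial generators. For a monomial $u=x_1^{a_1}\cdots x_n^{a_n}$ put $\mathrm{supp}(u)=\{x_i : a_i\neq 0\}$, and for a monomial $M$ write $[u,M]=1$ if $x_i^{a_i}\nmid M$ for all $x_i\in\mathrm{supp}(u)$, and $[u,M]\ne 1$ otherwise. Set $$I^u=(M\in\mathcal G(I) : [u,M]\neq 1),\qquad I_u=(M\in\mathcal G(I) : [u,M]=1).$$ The monomial $u$ is a shedding monomial for $I$ if $I_u\ne 0$ and for every $M\in\mathcal G(I_u)$ and every $x_\ell\in\mathrm{supp}(u)$ there is $N\in\mathcal G(I^u)$ with $N:M=x_\ell$, where $N:M=N/\gcd(N,M)$. For an integer $k$, a monomial ideal $I$ is (recursively) $k$-decomposable if $|\mathcal G(I)|=1$, or else it has a shedding monomial $u$ with $|\mathrm{supp}(u)|\le k+1$ such that $I_u$ and $I^u$ are $k$-decomposable. Let $I$ be a $k$-decomposable ideal and let $u$ be a shedding monomial for $I$ as in this definition, i.e. with $m=|\mathrm{supp}(u)|\le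 k+1$ and with $I_u$ and $I^u$ both $k$-decomposable. Then 1. $\mathrm{pd}(I)=\max\{\mathrm{pd}(I^u),\ \mathrm{pd}(I_u)+m\}$, and 2. $\mathrm{reg}(I)=\max\{\mathrm{reg}(I^u),\ \mathrm{reg}(I_u)\}$. Here $\mathrm{pd}$ is the projective dimension of the ideal as an $R$-module, and $\mathrm{reg}(I)=\max\{j-i : \beta_{i,j}(I)\neq 0\}$ is the Castelnuovo–Mumford regularity, where $\beta_{i,j}(I)=\dim_{\mathbb K}\mathrm{Tor}^R_i(\mathbb K,I)_j$ are the graded Betti numbers. -/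

import Mathlib

open MvPolynomial

namespace KDecomp

noncomputable section

variable {K : Type*} [Field K] {n : ℕ}

/-- A monomial ideal of `K[x_1, …, x_n]`: an ideal generated by a set of monomials. A monomial
`x_1^{a_1} ⋯ x_n^{a_n}` is represented by its exponent vector `a : Fin n →₀ ℕ`. -/
def IsMonomialIdeal (I : Ideal (MvPolynomial (Fin n) K)) : Prop :=
  ∃ A : Set (Fin n →₀ ℕ), I = Ideal.span ((fun a => monomial a (1 : K)) '' A)

/-- The (exponent vectors of the) minimal monomial generators `𝒢(I)` of a monomial ideal: the
monomials of `I` that are minimal for divisibility, which on exponents is the order `≤`. -/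
def minGens (I : Ideal (MvPolynomial (Fin n) K)) : Set (Fin n →₀ ℕ) :=
  {a | Minimal (fun b => monomial b (1 : K) ∈ I) a}

/-- `[u, M] = 1`: no `x_i ^ {a_i}` with `x_i ∈ supp u` divides `M`, where `a_i` is the exponent
of `x_i` in `u`. -/
def BracketEqOne (u M : Fin n →₀ ℕ) : Prop :=
  ∀ i ∈ u.support, ¬ u i ≤ M i

/-- `I_u`, generated by the `M ∈ 𝒢(I)` with `[u, M] = 1`. -/
def lowerIdeal (I : Ideal (MvPolynomial (Fin n) K)) (u : Fin n →₀ ℕ) :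
    Ideal (MvPolynomial (Fin n) K) :=
  Ideal.span ((fun a => monomial a (1 : K)) '' {M | M ∈ minGens I ∧ BracketEqOne u M})

/-- `I^u`, generated by the `M ∈ 𝒢(I)` with `[u, M] ≠ 1`. -/
def upperIdeal (I : Ideal (MvPolynomial (Fin n) K)) (u : Fin n →₀ ℕ) :
    Ideal (MvPolynomial (Fin n) K) :=
  Ideal.span ((fun a => monomial a (1 : K)) '' {M | M ∈ minGens I ∧ ¬ BracketEqOne u M})

/-- `u` is a shedding monomial for `I`: `I_u ≠ 0`, and for all `M ∈ 𝒢(I_u)` and `x_l ∈ supp u`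
there is `N ∈ 𝒢(I^u)` with `N : M = x_l`. The monomial `N : M = N / gcd(N, M)` has as exponent
vector the truncated difference `N - M`. -/
def IsSheddingMonomial (I : Ideal (MvPolynomial (Fin n) K)) (u : Fin n →₀ ℕ) : Prop :=
  lowerIdeal I u ≠ ⊥ ∧
    ∀ M ∈ minGens (lowerIdeal I u), ∀ l ∈ u.support,
      ∃ N ∈ minGens (upperIdeal I u), N - M = Finsupp.single l 1

/-- `k`-decomposable monomial ideals. -/
inductive IsDecomposable (k : ℤ) : Ideal (MvPolynomial (Fin n) K) → Prop
  | of_single (I : Ideal (MvPolynomial (Fin n) K)) (hI : IsMonomialIdeal I)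
      (h : (minGens I).ncard = 1) : IsDecomposable k I
  | of_shedding (I : Ideal (MvPolynomial (Fin n) K)) (hI : IsMonomialIdeal I)
      (u : Fin n →₀ ℕ) (hu : IsSheddingMonomial I u) (hk : (u.support.card : ℤ) ≤ k + 1)
      (hlower : IsDecomposable k (lowerIdeal I u))
      (hupper : IsDecomposable k (upperIdeal I u)) : IsDecomposable k I

/-- The Koszul differential for `x_1, …, x_n`. A family `c` of polynomials indexed by the subsets
of the variables stands for `∑_S c(S) e_S`, `e_S = e_{s_1} ∧ ⋯ ∧ e_{s_p}` for
`S = {s_1 < ⋯ < s_p}`, and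
`∂ (e_S) = ∑_{a ∈ S} (-1)^{#{b ∈ S : b < a}} x_a e_{S ∖ {a}}`;
below this is read off at each `T = S ∖ {a}`. -/
def koszulDiff : (Finset (Fin n) → MvPolynomial (Fin n) K) →ₗ[K]
    (Finset (Fin n) → MvPolynomial (Fin n) K) :=
  LinearMap.pi fun T => ∑ a ∈ Tᶜ,
    (LinearMap.mulLeft K
      ((-1 : MvPolynomial (Fin n) K) ^ (T.filter (fun b => b < a)).card * X a)) ∘ₗ
        LinearMap.proj (insert a T)

/-- The part of internal degree `j` of the `i`-th term `⊕_{|S| = i} I e_S` of the Koszul complex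
of `x_1, …, x_n` with coefficients in `I`, where `e_S` has degree `|S|`: the coefficients lie in
`I`, are supported on subsets of size `i`, and are homogeneous of degree `j - i`. -/
def koszulChains (I : Ideal (MvPolynomial (Fin n) K)) (i j : ℕ) :
    Submodule K (Finset (Fin n) → MvPolynomial (Fin n) K) where
  carrier := {c | ∀ S, c S ∈ I ∧ ∀ e ∈ (c S).support, S.card = i ∧ e.degree + i = j}
  zero_mem' := fun S => by simp
  add_mem' := by
    classical
    intro c d hc hd S
    refine ⟨I.add_mem (hc S).1 (hd S).1, fun e he => ?_⟩
    rcases Finset.mem_union.1 (support_add he) with h | h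
    · exact (hc S).2 e h
    · exact (hd S).2 e h
  smul_mem' := by
    intro r c hc S
    refine ⟨Submodule.smul_of_tower_mem I r (hc S).1, fun e he => ?_⟩
    exact (hc S).2 e (support_smul he)

/-- Cycles of homological degree `i` and internal degree `j`. -/
def koszulCycles (I : Ideal (MvPolynomial (Fin n) K)) (i j : ℕ) :
    Submodule K (Finset (Fin n) → MvPolynomial (Fin n) K) :=
  koszulChains I i j ⊓ LinearMap.ker koszulDiff

/-- Boundaries of homological degree `i` and internal degree `j`. -/
def koszulBoundaries (I : Ideal (MvPolynomial (Fin n) K)) (i j : ℕ) :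
    Submodule K (Finset (Fin n) → MvPolynomial (Fin n) K) :=
  (koszulChains I (i + 1) j).map koszulDiff

/-- `Tor_i(K, I)_j`, the graded `Tor` of `I` and of the residue field `K = R / (x_1, …, x_n)`,
`R = K[x_1, …, x_n]`: the homology of the standard graded free resolution of `K` (the Koszul
complex of `x_1, …, x_n`) tensored with `I`. -/
abbrev GradedTor (I : Ideal (MvPolynomial (Fin n) K)) (i j : ℕ) : Type _ :=
  koszulCycles I i j ⧸ (koszulBoundaries I i j).submoduleOf (koszulCycles I i j)

/-- The graded Betti number `β_{i,j}(I) = dim_K Tor_i(K, I)_j`. -/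
def gradedBetti (I : Ideal (MvPolynomial (Fin n) K)) (i j : ℕ) : ℕ :=
  Module.finrank K (GradedTor I i j)

/-- Castelnuovo–Mumford regularity `reg I = max {j - i : β_{i,j}(I) ≠ 0}`, with `reg 0 = -∞`.
As `I ⊆ K[x_1, …, x_n]` lives in nonnegative degrees, `β_{i,j}(I) = 0` for `j < i`, so only
natural numbers `d = j - i` occur. -/
def reg (I : Ideal (MvPolynomial (Fin n) K)) : WithBot ℕ∞ :=
  sSup {r | ∃ i j d : ℕ, gradedBetti I i j ≠ 0 ∧ j = i + d ∧ r = ((d : ℕ∞) : WithBot ℕ∞)}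

/-- The projective dimension of the ideal `I` as a module over `K[x_1, …, x_n]`. -/
def pd (I : Ideal (MvPolynomial (Fin n) K)) : WithBot ℕ∞ :=
  CategoryTheory.projectiveDimension (ModuleCat.of (MvPolynomial (Fin n) K) I)

end

end KDecomp

/-!
The argument goes through linear quotients. Order the minimal generators of `I` by listing those of
`I^u` first and those of `I_u` afterwards. Every `N ∈ 𝒢(I^u)` exceeds `M ∈ 𝒢(I_u)` in some
coordinate of `supp u`, and the shedding condition provides each variable of `supp u` as a quotient
`N : M`. Hence, if `I^u` and `I_u` have linear quotients, so does `I` (`HasLinearQuotients.shed`):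
the variables generating the colon ideal at `M` are those attached to `M` within `I_u` together
with `supp u`. The union is disjoint (`disjoint_support_of_shedding`), because the generators of
`I_u` all have exponent `u_l - 1` at `l ∈ supp u`. By induction decomposable ideals have linear
quotients (`IsDecomposable.exists_hasLinearQuotients`).

If `I` has linear quotients, with the variables `S f` attached to the generator `f`, then
`reg I = max deg f` (`HasLinearQuotients.reg_eq`) and `pd I = max #(S f)`
(`HasLinearQuotients.pd_eq`); the two formulas follow by comparing maxima.

* Division by a variable is a homotopy on the Koszul complex (`koszulDiff_divHomotopy`). It shows
  that the Koszul homology of `R / (x_t : t ∈ S)` in homological degree `i` lives in internal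
  degree `i`. Adding the generators one at a time, the Koszul homology of `I` in homological degree
  `i` vanishes above internal degree `i + max deg f`
  (`HasLinearQuotients.koszulCycles_le_koszulBoundaries`).
* For a generator `f`, the earlier generators of degree at most `deg f` again have linear quotients
  and contain all `g` with `x^g : x^f` a variable. By the vanishing for their ideal, `x^f e_{S f}`
  can be corrected to a cycle. It is not a boundary, since boundaries have coefficients in `𝔪 I`
  (`HasLinearQuotients.exists_cycle`).
* Attaching a generator `f` gives the quotient `R / (x_t : t ∈ S f)`, of projective dimension at
  most `#(S f)`; this bounds `pd I` from above. The cycle above bounds it from below, because Koszul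
  homology vanishes beyond the projective dimension (`koszulExactAt_of_hasProjectiveDimensionLT`).
-/

open MvPolynomial

namespace KDecomp

noncomputable section

variable {K : Type*} [Field K] {n : ℕ}

/-! ### The Koszul complex -/

/-- The sign `(-1)^{#{b ∈ T : b < a}}` of the Koszul differential, as a polynomial. -/
def koszulSign (K : Type*) [Field K] {n : ℕ} (T : Finset (Fin n)) (a : Fin n) :
    MvPolynomial (Fin n) K :=
  (-1) ^ (T.filter (fun b => b < a)).card

theorem koszulSign_mul_self (T : Finset (Fin n)) (a : Fin n) :
    koszulSign K T a * koszulSign K T a = 1 := by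
  rw [koszulSign, ← mul_pow]; simp

theorem koszulSign_insert {T : Finset (Fin n)} {a : Fin n} (ha : a ∉ T) (b : Fin n) :
    koszulSign K (insert a T) b = if a < b then -koszulSign K T b else koszulSign K T b := by
  unfold koszulSign
  rw [Finset.filter_insert]
  split_ifs with h
  · rw [Finset.card_insert_of_notMem (by simp [ha]), pow_succ]; ring
  · rfl

/-- Inserting two new elements in the two possible orders gives opposite signs. -/
theorem koszulSign_swap {T : Finset (Fin n)} {a b : Fin n} (ha : a ∉ T) (hb : b ∉ T)
    (hab : a ≠ b) :
    koszulSign K T a * koszulSign K (insert a T) b =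
      -(koszulSign K T b * koszulSign K (insert b T) a) := by
  rw [koszulSign_insert ha, koszulSign_insert hb]
  rcases lt_or_gt_of_ne hab with h | h
  · rw [if_pos h, if_neg h.not_gt]; ring
  · rw [if_neg h.not_gt, if_pos h]; ring

theorem koszulSign_swap' {T : Finset (Fin n)} {a b : Fin n} (ha : a ∉ T) (hb : b ∉ T)
    (hab : a ≠ b) :
    koszulSign K (insert b T) a * koszulSign K (insert a T) b =
      -(koszulSign K T b * koszulSign K T a) := by
  rw [koszulSign_insert ha, koszulSign_insert hb]
  rcases lt_or_gt_of_ne hab with h | h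
  · rw [if_pos h, if_neg h.not_gt]; ring
  · rw [if_neg h.not_gt, if_pos h]; ring

section Module

variable (M : Type*) [AddCommGroup M] [Module (MvPolynomial (Fin n) K) M]

/-- The Koszul differential of `x_1, …, x_n` with coefficients in a module `M`; the family `c`
stands for `∑_S c(S) e_S`, as for `koszulDiff`, which is the case `M = K[x_1, …, x_n]`. -/
def moduleKoszulDiff :
    (Finset (Fin n) → M) →ₗ[MvPolynomial (Fin n) K] (Finset (Fin n) → M) :=
  LinearMap.pi fun T => ∑ a ∈ Tᶜ, (koszulSign K T a * X a) • LinearMap.proj (insert a T)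

variable {M}

theorem moduleKoszulDiff_apply (c : Finset (Fin n) → M) (T : Finset (Fin n)) :
    moduleKoszulDiff (K := K) M c T =
      ∑ a ∈ Tᶜ, (koszulSign K T a * X a) • c (insert a T) := by
  simp [moduleKoszulDiff]

theorem moduleKoszulDiff_comp {N : Type*} [AddCommGroup N] [Module (MvPolynomial (Fin n) K) N]
    (φ : M →ₗ[MvPolynomial (Fin n) K] N) (c : Finset (Fin n) → M) :
    moduleKoszulDiff (K := K) N (fun T => φ (c T)) =
      fun T => φ (moduleKoszulDiff (K := K) M c T) := by
  funext T
  simp [moduleKoszulDiff_apply]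

theorem moduleKoszulDiff_sq (c : Finset (Fin n) → M) :
    moduleKoszulDiff (K := K) M (moduleKoszulDiff (K := K) M c) = 0 := by
  funext T
  rw [moduleKoszulDiff_apply, Pi.zero_apply]
  simp only [moduleKoszulDiff_apply, Finset.smul_sum, smul_smul]
  rw [Finset.sum_sigma']
  -- The terms for `(a, b)` and `(b, a)` cancel.
  refine Finset.sum_involution (fun p _ => ⟨p.2, p.1⟩) ?_ ?_ ?_ ?_
  · rintro ⟨a, b⟩ h
    simp only [Finset.mem_sigma, Finset.mem_compl, Finset.mem_insert, not_or] at h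
    obtain ⟨ha, hba, hb⟩ := h
    dsimp only
    rw [Finset.insert_comm a b T, ← add_smul]
    have h0 : koszulSign K T a * X a * (koszulSign K (insert a T) b * X b) +
        koszulSign K T b * X b * (koszulSign K (insert b T) a * X a) = 0 := by
      linear_combination (X a * X b) * koszulSign_swap (K := K) ha hb (Ne.symm hba)
    rw [h0, zero_smul]
  · rintro ⟨a, b⟩ h _ h'
    simp only [Finset.mem_sigma, Finset.mem_compl, Finset.mem_insert, not_or] at h
    simp only [Sigma.mk.injEq, heq_eq_eq] at h'
    exact h.2.1 h'.1
  · rintro ⟨a, b⟩ h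
    simp only [Finset.mem_sigma, Finset.mem_compl, Finset.mem_insert, not_or] at h ⊢
    exact ⟨h.2.2, Ne.symm h.2.1, h.1⟩
  · rintro ⟨a, b⟩ h
    rfl

end Module

theorem koszulDiff_eq (c : Finset (Fin n) → MvPolynomial (Fin n) K) :
    koszulDiff c = moduleKoszulDiff (K := K) (MvPolynomial (Fin n) K) c := by
  funext T
  simp [koszulDiff, moduleKoszulDiff_apply, koszulSign, mul_assoc]

theorem koszulDiff_apply (c : Finset (Fin n) → MvPolynomial (Fin n) K) (T : Finset (Fin n)) :
    koszulDiff c T = ∑ a ∈ Tᶜ, koszulSign K T a * X a * c (insert a T) := by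
  rw [koszulDiff_eq, moduleKoszulDiff_apply]; rfl

theorem koszulDiff_koszulDiff (c : Finset (Fin n) → MvPolynomial (Fin n) K) :
    koszulDiff (koszulDiff c) = 0 := by
  rw [koszulDiff_eq, koszulDiff_eq, moduleKoszulDiff_sq]

theorem koszulDiff_smul (p : MvPolynomial (Fin n) K)
    (c : Finset (Fin n) → MvPolynomial (Fin n) K) :
    koszulDiff (p • c) = p • koszulDiff c := by
  rw [koszulDiff_eq, koszulDiff_eq, map_smul]

theorem koszulDiff_mem {I : Ideal (MvPolynomial (Fin n) K)}
    {c : Finset (Fin n) → MvPolynomial (Fin n) K} (hc : ∀ T, c T ∈ I) (T : Finset (Fin n)) :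
    koszulDiff c T ∈ I := by
  rw [koszulDiff_apply]
  exact I.sum_mem fun a _ => I.mul_mem_left _ (hc _)

/-! ### Contracting a variable -/

/-- Division by `x_v` up to sign, placed at `e_{T ∪ {v}}`: a homotopy of the Koszul complex. -/
def divHomotopy (v : Fin n) (c : Finset (Fin n) → MvPolynomial (Fin n) K) :
    Finset (Fin n) → MvPolynomial (Fin n) K := fun T =>
  if v ∈ T then koszulSign K (T.erase v) v * (c (T.erase v)).divMonomial (Finsupp.single v 1)
  else 0

/-- The part of a Koszul chain that involves neither `e_v` nor the variable `x_v`. -/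
def dropVar (v : Fin n) (c : Finset (Fin n) → MvPolynomial (Fin n) K) :
    Finset (Fin n) → MvPolynomial (Fin n) K := fun T =>
  if v ∈ T then 0 else (c T).modMonomial (Finsupp.single v 1)

theorem divMonomial_single_X_mul {v a : Fin n} (hav : a ≠ v) (p : MvPolynomial (Fin n) K) :
    (X a * p).divMonomial (Finsupp.single v 1) = X a * p.divMonomial (Finsupp.single v 1) := by
  ext m
  rw [coeff_divMonomial, coeff_X_mul', coeff_X_mul', coeff_divMonomial]
  have : a ∈ (Finsupp.single v 1 + m).support ↔ a ∈ m.support := by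
    simp [hav.symm]
  by_cases h : a ∈ m.support
  · rw [if_pos (this.2 h), if_pos h]
    congr 1
    refine add_tsub_assoc_of_le ?_ _
    rw [Finsupp.single_le_iff]
    exact Nat.one_le_iff_ne_zero.2 (Finsupp.mem_support_iff.1 h)
  · rw [if_neg (fun h' => h (this.1 h')), if_neg h]

theorem koszulSign_eq_C (T : Finset (Fin n)) (a : Fin n) :
    ∃ r : K, koszulSign K T a = C r := ⟨(-1) ^ (T.filter (fun b => b < a)).card, by
  simp [koszulSign]⟩

theorem divMonomial_koszulSign_mul (T : Finset (Fin n)) (a : Fin n) (p : MvPolynomial (Fin n) K)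
    (m : Fin n →₀ ℕ) :
    (koszulSign K T a * p).divMonomial m = koszulSign K T a * p.divMonomial m := by
  obtain ⟨r, hr⟩ := koszulSign_eq_C (K := K) T a
  ext e
  simp [hr, coeff_divMonomial]

theorem divMonomial_sum {ι : Type*} (s : Finset ι) (f : ι → MvPolynomial (Fin n) K)
    (m : Fin n →₀ ℕ) :
    (∑ i ∈ s, f i).divMonomial m = ∑ i ∈ s, (f i).divMonomial m := by
  ext e
  simp [coeff_divMonomial, coeff_sum]

/-- The homotopy formula: the identity of the Koszul complex is homotopic to `dropVar v`. -/
theorem koszulDiff_divHomotopy (v : Fin n) (c : Finset (Fin n) → MvPolynomial (Fin n) K) :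
    c - koszulDiff (divHomotopy v c) = dropVar v c + divHomotopy v (koszulDiff c) := by
  funext T
  rw [Pi.sub_apply, Pi.add_apply, koszulDiff_apply]
  by_cases hv : v ∈ T
  · set U := T.erase v with hU
    have hTU : T = insert v U := (Finset.insert_erase hv).symm
    have hvU : v ∉ U := Finset.notMem_erase v T
    have hUc : Uᶜ = insert v Tᶜ := by
      rw [hU, Finset.compl_erase]
    rw [dropVar, if_pos hv, divHomotopy, if_pos hv, ← hU, koszulDiff_apply, divMonomial_sum, hUc,
      Finset.sum_insert (by simpa using hv), ← hTU, mul_assoc, divMonomial_koszulSign_mul,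
      X_mul_divMonomial, mul_add, ← mul_assoc, koszulSign_mul_self, one_mul, zero_add,
      sub_eq_add_neg, add_right_inj, Finset.mul_sum, ← Finset.sum_neg_distrib]
    refine Finset.sum_congr rfl fun a ha => ?_
    have haT : a ∉ T := by simpa using ha
    have hav : a ≠ v := fun h => haT (h ▸ hv)
    have haU : a ∉ U := fun h => haT (Finset.mem_of_mem_erase h)
    have he : (insert a T).erase v = insert a U := by
      rw [Finset.erase_insert_of_ne hav]
    rw [divHomotopy, if_pos (Finset.mem_insert_of_mem hv), he, mul_assoc (koszulSign K U a),
      divMonomial_koszulSign_mul, divMonomial_single_X_mul hav]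
    have := koszulSign_swap' (K := K) haU hvU hav
    rw [← hTU] at this
    linear_combination (-X a * (c (insert a U)).divMonomial (Finsupp.single v 1)) * this
  · rw [dropVar, if_neg hv, divHomotopy, if_neg hv, add_zero,
      Finset.sum_eq_single_of_mem v (by simpa using hv)]
    · rw [divHomotopy, if_pos (Finset.mem_insert_self v T), Finset.erase_insert hv]
      have h1 := koszulSign_mul_self (K := K) T v
      have h2 := divMonomial_add_modMonomial_single (c T) v
      linear_combination (-X v * (c T).divMonomial (Finsupp.single v 1)) * h1 - h2
    · intro a ha hav
      rw [divHomotopy, if_neg, mul_zero]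
      simp [hv, Ne.symm hav]

/-! ### Graded Koszul chains -/

/-- A Koszul chain of homological degree `i` all of whose terms `x^e e_T` have an internal degree
satisfying `p`. The choice `p = (· = j)` gives the chains of internal degree `j`, and `p = ⊤`
drops the condition on the internal degree. -/
def IsKoszulChain (p : ℕ → Prop) (i : ℕ) (c : Finset (Fin n) → MvPolynomial (Fin n) K) : Prop :=
  ∀ T, ∀ e ∈ (c T).support, T.card = i ∧ p (e.degree + i)

theorem mem_koszulChains {I : Ideal (MvPolynomial (Fin n) K)} {i j : ℕ}
    {c : Finset (Fin n) → MvPolynomial (Fin n) K} :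
    c ∈ koszulChains I i j ↔ (∀ T, c T ∈ I) ∧ IsKoszulChain (· = j) i c :=
  ⟨fun h => ⟨fun T => (h T).1, fun T => (h T).2⟩, fun h T => ⟨h.1 T, h.2 T⟩⟩

theorem mem_support_koszulSign_mul (T : Finset (Fin n)) (a : Fin n) (p : MvPolynomial (Fin n) K)
    (e : Fin n →₀ ℕ) :
    e ∈ (koszulSign K T a * p).support ↔ e ∈ p.support := by
  have h := koszulSign_mul_self (K := K) T a
  obtain ⟨r, hr⟩ := koszulSign_eq_C (K := K) T a
  have hr0 : r ≠ 0 := by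
    rintro rfl
    rw [hr] at h
    simp at h
  simp [hr, hr0]

theorem mem_support_of_mem_support_dropVar {v : Fin n}
    {c : Finset (Fin n) → MvPolynomial (Fin n) K}
    {T : Finset (Fin n)} {e : Fin n →₀ ℕ} (he : e ∈ (dropVar v c T).support) :
    e ∈ (c T).support ∧ v ∉ T ∧ e v = 0 := by
  rw [dropVar] at he
  split_ifs at he with hv
  · simp at he
  · rw [mem_support_iff] at he
    have : ¬ Finsupp.single v 1 ≤ e := fun h => he (coeff_modMonomial_of_le _ h)
    rw [coeff_modMonomial_of_not_le _ this, ← mem_support_iff] at he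
    rw [Finsupp.single_le_iff] at this
    exact ⟨he, hv, by omega⟩

namespace IsKoszulChain

variable {p : ℕ → Prop} {i : ℕ} {c d : Finset (Fin n) → MvPolynomial (Fin n) K}

theorem add (hc : IsKoszulChain p i c) (hd : IsKoszulChain p i d) : IsKoszulChain p i (c + d) := by
  classical
  intro T e he
  rcases Finset.mem_union.1 (support_add he) with h | h
  exacts [hc T e h, hd T e h]

theorem sub (hc : IsKoszulChain p i c) (hd : IsKoszulChain p i d) : IsKoszulChain p i (c - d) := by
  classical
  intro T e he
  rcases Finset.mem_union.1 (support_sub _ _ _ he) with h | h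
  exacts [hc T e h, hd T e h]

theorem diff (hc : IsKoszulChain p (i + 1) c) : IsKoszulChain p i (koszulDiff c) := by
  classical
  intro T e he
  rw [koszulDiff_apply] at he
  obtain ⟨a, ha, he⟩ := Finset.mem_biUnion.1 (support_sum he)
  rw [mul_assoc, mem_support_koszulSign_mul, support_X_mul, Finset.mem_map] at he
  obtain ⟨e', he', rfl⟩ := he
  obtain ⟨h1, h2⟩ := hc _ _ he'
  rw [Finset.card_insert_of_notMem (by simpa using ha)] at h1
  refine ⟨by omega, ?_⟩
  convert h2 using 1
  simp only [addLeftEmbedding_apply, map_add, Finsupp.degree_single]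
  omega

theorem divHomotopy (v : Fin n) (hc : IsKoszulChain p i c) :
    IsKoszulChain p (i + 1) (divHomotopy v c) := by
  intro T e he
  rw [KDecomp.divHomotopy] at he
  split_ifs at he with hv
  · rw [mem_support_koszulSign_mul, mem_support_iff, coeff_divMonomial, ← mem_support_iff] at he
    obtain ⟨h1, h2⟩ := hc _ _ he
    rw [Finset.card_erase_of_mem hv] at h1
    have := Finset.card_pos.2 ⟨v, hv⟩
    refine ⟨by omega, ?_⟩
    convert h2 using 1
    simp only [map_add, Finsupp.degree_single]
    omega
  · simp at he

theorem dropVar (v : Fin n) (hc : IsKoszulChain p i c) : IsKoszulChain p i (dropVar v c) :=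
  fun T e he => hc T e (mem_support_of_mem_support_dropVar he).1

theorem smul_monomial {f : Fin n →₀ ℕ} (hc : IsKoszulChain (fun m => p (m + f.degree)) i c) :
    IsKoszulChain p i (monomial f (1 : K) • c) := by
  intro T e he
  rw [Pi.smul_apply, smul_eq_mul, mem_support_iff, coeff_monomial_mul'] at he
  split_ifs at he with h
  · rw [one_mul, ← mem_support_iff] at he
    obtain ⟨h1, h2⟩ := hc T _ he
    refine ⟨h1, ?_⟩
    have : e.degree = (e - f).degree + f.degree := by
      rw [← map_add, tsub_add_cancel_of_le h]
    rwa [this, add_right_comm]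
  · exact absurd rfl he

end IsKoszulChain

/-! ### Koszul homology modulo variables -/

/-- The ideal generated by the variables `x_t`, `t ∈ S`. -/
def varIdeal (K : Type*) [Field K] {n : ℕ} (S : Finset (Fin n)) : Ideal (MvPolynomial (Fin n) K) :=
  Ideal.span (X '' (S : Set (Fin n)))

theorem mem_varIdeal {S : Finset (Fin n)} {p : MvPolynomial (Fin n) K} :
    p ∈ varIdeal K S ↔ ∀ e ∈ p.support, ∃ t ∈ S, e t ≠ 0 :=
  mem_ideal_span_X_image

theorem divHomotopy_mem_varIdeal {S : Finset (Fin n)} {v : Fin n} (hv : v ∉ S)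
    {c : Finset (Fin n) → MvPolynomial (Fin n) K} (hc : ∀ T, c T ∈ varIdeal K S)
    (T : Finset (Fin n)) : divHomotopy v c T ∈ varIdeal K S := by
  rw [divHomotopy]
  split_ifs
  · refine Ideal.mul_mem_left _ _ (mem_varIdeal.2 fun e he => ?_)
    rw [mem_support_iff, coeff_divMonomial, ← mem_support_iff] at he
    obtain ⟨t, ht, h⟩ := mem_varIdeal.1 (hc _) _ he
    refine ⟨t, ht, ?_⟩
    have : v ≠ t := fun h => hv (h ▸ ht)
    simpa [this] using h
  · exact zero_mem _

/-- Modulo boundaries, a chain that is a cycle modulo `(x_t : t ∈ S)` can be made independent of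
all `x_v` and `e_v` with `v ∈ V`, as long as `V` is disjoint from `S`. -/
theorem exists_eliminate {S V : Finset (Fin n)} (hSV : Disjoint S V) {p : ℕ → Prop} {i : ℕ}
    {g : Finset (Fin n) → MvPolynomial (Fin n) K} (hg : IsKoszulChain p i g)
    (hd : ∀ T, koszulDiff g T ∈ varIdeal K S) :
    ∃ b g' : Finset (Fin n) → MvPolynomial (Fin n) K,
      IsKoszulChain p (i + 1) b ∧ IsKoszulChain p i g' ∧
      (∀ T, (g - koszulDiff b - g') T ∈ varIdeal K S) ∧
      ∀ T, ∀ e ∈ (g' T).support, ∀ v ∈ V, v ∉ T ∧ e v = 0 := by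
  classical
  induction V using Finset.induction_on with
  | empty => exact ⟨0, g, fun T e he => by simp at he, hg, fun T => by simp, by simp⟩
  | insert v V hvV ih =>
    rw [Finset.disjoint_insert_right] at hSV
    obtain ⟨b, g', hb, hg', hmem, hV⟩ := ih hSV.2
    refine ⟨b + divHomotopy v g', dropVar v g', hb.add (hg'.divHomotopy v), hg'.dropVar v, ?_, ?_⟩
    · have hd' : ∀ T, koszulDiff g' T ∈ varIdeal K S := fun T => by
        have h1 := koszulDiff_mem hmem T
        rw [map_sub, map_sub, koszulDiff_koszulDiff, sub_zero] at h1
        have := sub_mem (hd T) h1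
        simpa using this
      have key : g - koszulDiff (b + divHomotopy v g') - dropVar v g' =
          (g - koszulDiff b - g') + divHomotopy v (koszulDiff g') := by
        have := koszulDiff_divHomotopy v g'
        rw [map_add]
        linear_combination this
      intro T
      rw [key]
      exact add_mem (hmem T) (divHomotopy_mem_varIdeal hSV.1 hd' T)
    · intro T e he w hw
      obtain ⟨h1, h2⟩ := mem_support_of_mem_support_dropVar he
      rcases Finset.mem_insert.1 hw with rfl | hw
      exacts [h2, hV T e h1 w hw]

/-- The Koszul complex of `K[x_1, …, x_n]` is exact in positive homological degrees. -/
theorem exists_koszulDiff_eq {p : ℕ → Prop} {i : ℕ} (hi : i ≠ 0)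
    {g : Finset (Fin n) → MvPolynomial (Fin n) K} (hg : IsKoszulChain p i g)
    (hd : koszulDiff g = 0) : ∃ b, IsKoszulChain p (i + 1) b ∧ koszulDiff b = g := by
  obtain ⟨b, g', hb, hg', hmem, hV⟩ := exists_eliminate (S := ∅) (V := Finset.univ)
    (Finset.disjoint_empty_left _) hg (fun T => by rw [hd]; exact zero_mem _)
  refine ⟨b, hb, ?_⟩
  have h0 : g' = 0 := by
    funext T
    refine support_eq_empty.1 (Finset.eq_empty_of_forall_notMem fun e he => ?_)
    have hT := (hg' T e he).1
    obtain ⟨v, hv⟩ := Finset.card_pos.1 (by omega : 0 < T.card)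
    exact (hV T e he v (Finset.mem_univ v)).1 hv
  funext T
  have := hmem T
  rw [h0, varIdeal, Finset.coe_empty, Set.image_empty, Ideal.span_empty, Ideal.mem_bot] at this
  rw [sub_zero, Pi.sub_apply] at this
  exact (sub_eq_zero.1 this).symm

/-- The Koszul homology of `K[x_1, …, x_n] / (x_t : t ∈ S)` in homological degree `i` lives in
internal degree `i` only. -/
theorem exists_sub_koszulDiff_mem_varIdeal {S : Finset (Fin n)} {p : ℕ → Prop} {i : ℕ}
    (hi : ¬ p i) {g : Finset (Fin n) → MvPolynomial (Fin n) K} (hg : IsKoszulChain p i g)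
    (hd : ∀ T, koszulDiff g T ∈ varIdeal K S) :
    ∃ b : Finset (Fin n) → MvPolynomial (Fin n) K,
      IsKoszulChain p (i + 1) b ∧ ∀ T, (g - koszulDiff b) T ∈ varIdeal K S := by
  obtain ⟨b, g', hb, hg', hmem, hV⟩ := exists_eliminate (V := Sᶜ)
    disjoint_compl_right hg hd
  refine ⟨b, hb, fun T => ?_⟩
  have : g' T ∈ varIdeal K S := by
    refine mem_varIdeal.2 fun e he => ?_
    by_contra! h
    -- After eliminating all variables outside `S`, a term with no variable in `S` is constant.
    have he0 : e = 0 := by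
      ext v
      by_cases hv : v ∈ S
      · exact h v hv
      · exact (hV T e he v (by simpa using hv)).2
    have := (hg' T e he).2
    rw [he0, map_zero, zero_add] at this
    exact hi this
  simpa using add_mem (hmem T) this

/-! ### Adding a generator to a monomial ideal -/

/-- The monomial ideal generated by the monomials with exponents in `A`. -/
def monIdeal (K : Type*) [Field K] {n : ℕ} (A : Set (Fin n →₀ ℕ)) :
    Ideal (MvPolynomial (Fin n) K) :=
  Ideal.span ((fun a => monomial a (1 : K)) '' A)

theorem mem_monIdeal {A : Set (Fin n →₀ ℕ)} {p : MvPolynomial (Fin n) K} :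
    p ∈ monIdeal K A ↔ ∀ e ∈ p.support, ∃ a ∈ A, a ≤ e :=
  mem_ideal_span_monomial_image

theorem monomial_mem_monIdeal {A : Set (Fin n →₀ ℕ)} {e : Fin n →₀ ℕ} :
    monomial e (1 : K) ∈ monIdeal K A ↔ ∃ a ∈ A, a ≤ e := by
  classical
  rw [mem_monIdeal, support_monomial, if_neg one_ne_zero]
  simp

/-- If every element of `A` exceeds `f` in a coordinate of `S`, and each `f + e_t`, `t ∈ S`, lies
above an element of `A`, then the colon ideal of `A` by `f` is generated by the variables
in `S`. -/
theorem monomial_mul_mem_monIdeal {A : Set (Fin n →₀ ℕ)} {f : Fin n →₀ ℕ} {S : Finset (Fin n)}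
    (hA : ∀ g ∈ A, ∃ t ∈ S, f t < g t)
    (hS : ∀ t ∈ S, ∃ g ∈ A, g ≤ f + Finsupp.single t 1)
    {p : MvPolynomial (Fin n) K} :
    monomial f (1 : K) * p ∈ monIdeal K A ↔ p ∈ varIdeal K S := by
  rw [mem_monIdeal, mem_varIdeal]
  constructor
  · intro h e he
    obtain ⟨a, ha, hae⟩ := h (f + e) (by
      rw [mem_support_iff, coeff_monomial_mul, one_mul]; exact mem_support_iff.1 he)
    obtain ⟨t, ht, hlt⟩ := hA a ha
    refine ⟨t, ht, ?_⟩
    have := hae t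
    rw [Finsupp.add_apply] at this
    omega
  · intro h e he
    rw [mem_support_iff, coeff_monomial_mul'] at he
    split_ifs at he with hfe
    · rw [one_mul, ← mem_support_iff] at he
      obtain ⟨t, ht, h0⟩ := h _ he
      obtain ⟨g, hg, hgf⟩ := hS t ht
      refine ⟨g, hg, hgf.trans ?_⟩
      rw [← tsub_add_cancel_of_le hfe, add_comm]
      refine add_le_add_left ?_ _
      rw [Finsupp.single_le_iff]
      exact Nat.one_le_iff_ne_zero.2 h0
    · exact absurd rfl he

/-- For `I = J + (x^f)` with `J : x^f` generated by variables, the Koszul homology of `I / J`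
in homological degree `i` lives in internal degree `i + deg f` only. -/
theorem exists_sub_koszulDiff_mem_monIdeal {A : Set (Fin n →₀ ℕ)} {f : Fin n →₀ ℕ}
    {S : Finset (Fin n)} (hA : ∀ g ∈ A, ∃ t ∈ S, f t < g t)
    (hS : ∀ t ∈ S, ∃ g ∈ A, g ≤ f + Finsupp.single t 1) {i j : ℕ} (hj : j ≠ i + f.degree)
    {c : Finset (Fin n) → MvPolynomial (Fin n) K}
    (hc : c ∈ koszulChains (monIdeal K (insert f A)) i j) (hd : koszulDiff c = 0) :
    ∃ b ∈ koszulChains (monIdeal K (insert f A)) (i + 1) j,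
      c - koszulDiff b ∈ koszulChains (monIdeal K A) i j := by
  rw [mem_koszulChains] at hc
  obtain ⟨hcI, hc⟩ := hc
  -- Split `c = x^f g + y`, where `y` collects the terms not divisible by `x^f`; these lie in `J`.
  set g : Finset (Fin n) → MvPolynomial (Fin n) K := fun T => (c T).divMonomial f with hgdef
  set y : Finset (Fin n) → MvPolynomial (Fin n) K := fun T => (c T).modMonomial f with hydef
  have hcy : c = monomial f (1 : K) • g + y := by
    funext T
    exact (divMonomial_add_modMonomial (c T) f).symm
  have hy : ∀ T, y T ∈ monIdeal K A := fun T => by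
    refine mem_monIdeal.2 fun e he => ?_
    rw [mem_support_iff] at he
    have hfe : ¬ f ≤ e := fun h => he (coeff_modMonomial_of_le _ h)
    rw [coeff_modMonomial_of_not_le _ hfe, ← mem_support_iff] at he
    obtain ⟨a, ha, hae⟩ := mem_monIdeal.1 (hcI T) e he
    rcases ha with rfl | ha
    exacts [absurd hae hfe, ⟨a, ha, hae⟩]
  have hg : IsKoszulChain (fun m => m + f.degree = j) i g := fun T e he => by
    rw [mem_support_iff, coeff_divMonomial, ← mem_support_iff] at he
    obtain ⟨h1, h2⟩ := hc T _ he
    rw [map_add] at h2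
    exact ⟨h1, by omega⟩
  have hdg : ∀ T, koszulDiff g T ∈ varIdeal K S := fun T => by
    rw [← monomial_mul_mem_monIdeal hA hS]
    have h1 := koszulDiff_mem hy T
    have h2 : monomial f (1 : K) * koszulDiff g T = -koszulDiff y T := by
      rw [eq_neg_iff_add_eq_zero]
      have := congrFun hd T
      rwa [hcy, map_add, koszulDiff_smul] at this
    rw [h2]
    exact neg_mem h1
  obtain ⟨b, hb, hmem⟩ := exists_sub_koszulDiff_mem_varIdeal (by omega) hg hdg
  have hbc : IsKoszulChain (· = j) (i + 1) (monomial f (1 : K) • b) := hb.smul_monomial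
  refine ⟨monomial f (1 : K) • b, mem_koszulChains.2 ⟨fun T => ?_, hbc⟩,
    mem_koszulChains.2 ⟨fun T => ?_, hc.sub hbc.diff⟩⟩
  · exact Ideal.mul_mem_right _ _ (Ideal.subset_span ⟨f, Set.mem_insert _ _, rfl⟩)
  · have : (c - koszulDiff (monomial f (1 : K) • b)) T =
        monomial f (1 : K) * (g - koszulDiff b) T + y T := by
      rw [hcy, koszulDiff_smul]
      simp only [Pi.sub_apply, Pi.add_apply, Pi.smul_apply, smul_eq_mul]
      ring
    rw [this]
    exact add_mem ((monomial_mul_mem_monIdeal hA hS).2 (hmem T)) (hy T)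

/-! ### Linear quotients -/

/-- The monomials with exponents in `G` are pairwise incomparable and have linear quotients in the
order given by `ord`: for `f ∈ G`, the ideal `(x^g : g ∈ G, ord g < ord f) : x^f` is generated
by the variables `x_t`, `t ∈ S f`. Both inclusions are stated on exponents. -/
structure HasLinearQuotients (G : Finset (Fin n →₀ ℕ)) (ord : (Fin n →₀ ℕ) → ℕ)
    (S : (Fin n →₀ ℕ) → Finset (Fin n)) : Prop where
  antichain : IsAntichain (· ≤ ·) (G : Set (Fin n →₀ ℕ))
  injOn : Set.InjOn ord G
  exists_sub_eq : ∀ f ∈ G, ∀ t ∈ S f, ∃ g ∈ G, ord g < ord f ∧ g - f = Finsupp.single t 1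
  exists_lt : ∀ f ∈ G, ∀ g ∈ G, ord g < ord f → ∃ t ∈ S f, f t < g t

theorem eq_of_le_of_degree_le {g h : Fin n →₀ ℕ} (hgh : g ≤ h) (hd : h.degree ≤ g.degree) :
    g = h := by
  have h1 : h - g + g = h := tsub_add_cancel_of_le hgh
  have h2 : (h - g).degree + g.degree = h.degree := by rw [← map_add, h1]
  have h3 : h - g = 0 := (Finsupp.degree_eq_zero_iff _).1 (by omega)
  rw [← h1, h3, zero_add]

theorem degree_le_of_sub_eq_single {f g : Fin n →₀ ℕ} {t : Fin n}
    (h : g - f = Finsupp.single t 1) (hfg : ¬ f ≤ g) : g.degree ≤ f.degree := by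
  have h1 : g ≤ f + Finsupp.single t 1 := by rw [← h]; exact le_add_tsub
  by_contra! hlt
  have h2 : g = f + Finsupp.single t 1 :=
    eq_of_le_of_degree_le h1 (by rw [map_add, Finsupp.degree_single]; omega)
  exact hfg (by rw [h2]; exact le_self_add)

namespace HasLinearQuotients

variable {G : Finset (Fin n →₀ ℕ)} {ord : (Fin n →₀ ℕ) → ℕ}
  {S : (Fin n →₀ ℕ) → Finset (Fin n)}

/-- Linear quotients are inherited by a subfamily that contains with `f` all earlier members
of degree at most `deg f`, because the members `g` with `x^g : x^f = x_t` have
`deg g ≤ deg f`. -/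
theorem subset (h : HasLinearQuotients G ord S) {G' : Finset (Fin n →₀ ℕ)} (hG' : G' ⊆ G)
    (hclosed : ∀ f ∈ G', ∀ g ∈ G, ord g < ord f → g.degree ≤ f.degree → g ∈ G') :
    HasLinearQuotients G' ord S where
  antichain := h.antichain.subset (by exact_mod_cast hG')
  injOn := h.injOn.mono (by exact_mod_cast hG')
  exists_sub_eq f hf t ht := by
    obtain ⟨g, hg, hlt, hgf⟩ := h.exists_sub_eq f (hG' hf) t ht
    have hne : f ≠ g := fun e => by rw [e] at hlt; exact lt_irrefl _ hlt
    exact ⟨g, hclosed f hf g hg hlt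
      (degree_le_of_sub_eq_single hgf (h.antichain (hG' hf) hg hne)), hlt, hgf⟩
  exists_lt f hf g hg := h.exists_lt f (hG' hf) g (hG' hg)

/-- Removing the last member keeps linear quotients. -/
theorem of_insert {f : Fin n →₀ ℕ} (hf : f ∉ G) (hmax : ∀ g ∈ G, ord g ≤ ord f)
    (h : HasLinearQuotients (insert f G) ord S) : HasLinearQuotients G ord S := by
  refine h.subset (Finset.subset_insert _ _) fun g hg k hk hlt _ => ?_
  rcases Finset.mem_insert.1 hk with rfl | hk
  exacts [absurd (hmax g hg) (not_le.2 hlt), hk]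

theorem lt_of_insert {f : Fin n →₀ ℕ} (hf : f ∉ G) (hmax : ∀ g ∈ G, ord g ≤ ord f)
    (h : HasLinearQuotients (insert f G) ord S) : ∀ g ∈ G, ord g < ord f := by
  intro g hg
  refine lt_of_le_of_ne (hmax g hg) fun he => hf ?_
  rw [← h.injOn (by simp [hg]) (by simp) he]
  exact hg

theorem exists_lt_of_insert {f : Fin n →₀ ℕ} (hf : f ∉ G) (hmax : ∀ g ∈ G, ord g ≤ ord f)
    (h : HasLinearQuotients (insert f G) ord S) :
    ∀ g ∈ (G : Set (Fin n →₀ ℕ)), ∃ t ∈ S f, f t < g t := fun g hg =>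
  h.exists_lt f (Finset.mem_insert_self _ _) g (Finset.mem_insert_of_mem hg)
    (lt_of_insert hf hmax h g hg)

theorem exists_le_of_insert {f : Fin n →₀ ℕ}
    (h : HasLinearQuotients (insert f G) ord S) :
    ∀ t ∈ S f, ∃ g ∈ (G : Set (Fin n →₀ ℕ)), g ≤ f + Finsupp.single t 1 := by
  intro t ht
  obtain ⟨g, hg, hlt, hgf⟩ := h.exists_sub_eq f (Finset.mem_insert_self _ _) t ht
  refine ⟨g, ?_, hgf ▸ le_add_tsub⟩
  rcases Finset.mem_insert.1 hg with rfl | hg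
  exacts [absurd hlt (lt_irrefl _), hg]

/-- An ideal with linear quotients has no Koszul homology in homological degree `i` above internal
degree `i + d`, where `d` is the largest degree of a generator. -/
theorem koszulCycles_le_koszulBoundaries (h : HasLinearQuotients G ord S) {i j : ℕ}
    (hj : ∀ f ∈ G, i + f.degree < j) :
    koszulCycles (monIdeal K (G : Set (Fin n →₀ ℕ))) i j ≤
      koszulBoundaries (monIdeal K (G : Set (Fin n →₀ ℕ))) i j := by
  induction G using Finset.induction_on_max_value ord with
  | empty =>
    rintro c ⟨hc, -⟩
    have : c = 0 := by
      funext T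
      have := (hc T).1
      rw [monIdeal, Finset.coe_empty, Set.image_empty, Ideal.span_empty, Ideal.mem_bot] at this
      exact this
    rw [this]
    exact zero_mem _
  | insert f G hf hmax ih =>
    rintro c ⟨hc, hd⟩
    rw [SetLike.mem_coe, Finset.coe_insert] at hc
    rw [SetLike.mem_coe, LinearMap.mem_ker] at hd
    obtain ⟨b, hb, hcb⟩ := exists_sub_koszulDiff_mem_monIdeal (exists_lt_of_insert hf hmax h)
      (exists_le_of_insert h) (hj f (Finset.mem_insert_self _ _)).ne' hc hd
    have hcyc : c - koszulDiff b ∈ koszulCycles (monIdeal K (G : Set (Fin n →₀ ℕ))) i j :=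
      ⟨hcb, by rw [SetLike.mem_coe, LinearMap.mem_ker, map_sub, hd, koszulDiff_koszulDiff,
        sub_zero]⟩
    obtain ⟨b', hb', he⟩ := ih (of_insert hf hmax h)
      (fun g hg => hj g (Finset.mem_insert_of_mem hg)) hcyc
    rw [Finset.coe_insert]
    refine ⟨b' + b, add_mem (fun T => ⟨?_, (hb' T).2⟩) hb, by rw [map_add, he, sub_add_cancel]⟩
    exact Ideal.span_mono (Set.image_mono (Set.subset_insert _ _)) (hb' T).1

end HasLinearQuotients

/-- Boundaries of a monomial ideal have coefficients in `𝔪 I`, so they involve no minimal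
generator. -/
theorem coeff_koszulDiff_eq_zero {A : Set (Fin n →₀ ℕ)} {f : Fin n →₀ ℕ}
    (hf : ∀ g ∈ A, g ≤ f → g = f) {b : Finset (Fin n) → MvPolynomial (Fin n) K}
    (hb : ∀ T, b T ∈ monIdeal K A) (T : Finset (Fin n)) : coeff f (koszulDiff b T) = 0 := by
  classical
  by_contra hne
  rw [← Ne, ← mem_support_iff, koszulDiff_apply] at hne
  obtain ⟨a, ha, he⟩ := Finset.mem_biUnion.1 (support_sum hne)
  rw [mul_assoc, mem_support_koszulSign_mul, support_X_mul, Finset.mem_map] at he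
  obtain ⟨e', he', rfl⟩ := he
  obtain ⟨g, hg, hge⟩ := mem_monIdeal.1 (hb _) e' he'
  rw [addLeftEmbedding_apply] at hf
  have h1 := hf g hg (hge.trans le_add_self)
  have h2 := hge a
  rw [h1] at h2
  simp at h2

namespace HasLinearQuotients

variable {G : Finset (Fin n →₀ ℕ)} {ord : (Fin n →₀ ℕ) → ℕ}
  {S : (Fin n →₀ ℕ) → Finset (Fin n)}

/-- Every member `f` of a family with linear quotients contributes to the Koszul homology of the
ideal in homological degree `#(S f)`: the chain `x^f e_{S f}` can be corrected to a cycle by a chain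
with coefficients in the ideal of the earlier members of degree at most `deg f`. -/
theorem exists_cycle (K : Type*) [Field K] (h : HasLinearQuotients G ord S) {f : Fin n →₀ ℕ}
    (hf : f ∈ G) :
    ∃ z : Finset (Fin n) → MvPolynomial (Fin n) K,
      z ∈ koszulCycles (monIdeal K (G : Set (Fin n →₀ ℕ))) (S f).card ((S f).card + f.degree) ∧
      ∀ b : Finset (Fin n) → MvPolynomial (Fin n) K,
        (∀ T, b T ∈ monIdeal K (G : Set (Fin n →₀ ℕ))) → koszulDiff b ≠ z := by
  classical
  set q := (S f).card with hq
  set G' : Finset (Fin n →₀ ℕ) := G.filter fun g => ord g < ord f ∧ g.degree ≤ f.degree with hG'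
  have hG'G : G' ⊆ G := Finset.filter_subset _ _
  have hle : monIdeal K (G' : Set (Fin n →₀ ℕ)) ≤ monIdeal K (G : Set (Fin n →₀ ℕ)) :=
    Ideal.span_mono (Set.image_mono (by exact_mod_cast hG'G))
  have hLQ : HasLinearQuotients G' ord S := by
    refine h.subset hG'G fun g hg k hk hlt hdeg => ?_
    rw [hG', Finset.mem_filter] at hg ⊢
    exact ⟨hk, hlt.trans hg.2.1, hdeg.trans hg.2.2⟩
  have hmin : ∀ g ∈ (G : Set (Fin n →₀ ℕ)), g ≤ f → g = f := fun g hg hgf => by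
    by_contra hne
    exact h.antichain hg hf hne hgf
  set c : Finset (Fin n) → MvPolynomial (Fin n) K := Pi.single (S f) (monomial f 1) with hc
  have hcchain : c ∈ koszulChains (monIdeal K (G : Set (Fin n →₀ ℕ))) q (q + f.degree) := by
    intro T
    by_cases hT : T = S f
    · subst hT
      rw [hc, Pi.single_eq_same]
      refine ⟨Ideal.subset_span ⟨f, hf, rfl⟩, fun e he => ?_⟩
      rw [support_monomial, if_neg one_ne_zero, Finset.mem_singleton] at he
      exact ⟨rfl, by rw [he, add_comm]⟩
    · rw [hc, Pi.single_eq_of_ne hT]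
      exact ⟨zero_mem _, by simp⟩
  have hdc : ∀ T, koszulDiff c T ∈ monIdeal K (G' : Set (Fin n →₀ ℕ)) := fun T => by
    rw [koszulDiff_apply]
    refine Ideal.sum_mem _ fun a ha => ?_
    by_cases hT : insert a T = S f
    · obtain ⟨g, hg, hlt, hgf⟩ := h.exists_sub_eq f hf a (hT ▸ Finset.mem_insert_self _ _)
      have hne : f ≠ g := fun e => by rw [e] at hlt; exact lt_irrefl _ hlt
      have hdeg := degree_le_of_sub_eq_single hgf (h.antichain hf hg hne)
      rw [mul_assoc, hc, hT, Pi.single_eq_same, X, monomial_mul, mul_one]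
      refine Ideal.mul_mem_left _ _ (monomial_mem_monIdeal.2 ⟨g, ?_, ?_⟩)
      · rw [Finset.mem_coe, hG', Finset.mem_filter]
        exact ⟨hg, hlt, hdeg⟩
      · rw [add_comm, ← hgf]
        exact le_add_tsub
    · rw [hc, Pi.single_eq_of_ne hT, mul_zero]
      exact zero_mem _
  obtain ⟨b, hb, hdb⟩ : ∃ b ∈ koszulChains (monIdeal K (G' : Set (Fin n →₀ ℕ))) q (q + f.degree),
      koszulDiff b = koszulDiff c := by
    rcases Nat.eq_zero_or_eq_succ_pred q with h0 | h0
    · refine ⟨0, zero_mem _, ?_⟩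
      funext T
      rw [map_zero, koszulDiff_apply, Pi.zero_apply, eq_comm]
      refine Finset.sum_eq_zero fun a _ => ?_
      rw [hc, Pi.single_eq_of_ne, mul_zero]
      intro he
      have : a ∈ S f := he ▸ Finset.mem_insert_self _ _
      have := Finset.card_pos.2 ⟨a, this⟩
      omega
    · obtain ⟨q', hq'⟩ : ∃ q', q = q' + 1 := ⟨_, h0⟩
      rw [hq'] at hcchain ⊢
      obtain ⟨b, hb, he⟩ := hLQ.koszulCycles_le_koszulBoundaries (K := K) (i := q')
        (j := q' + 1 + f.degree)
        (fun g hg => by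
          rw [hG', Finset.mem_filter] at hg
          have := hg.2.2
          omega)
        (Submodule.mem_inf.2 ⟨mem_koszulChains.2 ⟨hdc, (mem_koszulChains.1 hcchain).2.diff⟩,
          koszulDiff_koszulDiff c⟩)
      exact ⟨b, hb, he⟩
  refine ⟨c - b, ⟨sub_mem hcchain fun T => ⟨hle (hb T).1, (hb T).2⟩, ?_⟩, fun b' hb' he => ?_⟩
  · rw [SetLike.mem_coe, LinearMap.mem_ker, map_sub, hdb, sub_self]
  · have h1 := coeff_koszulDiff_eq_zero hmin hb' (S f)
    rw [he, Pi.sub_apply, coeff_sub, hc, Pi.single_eq_same, coeff_monomial, if_pos rfl] at h1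
    have h2 : coeff f (b (S f)) = 0 := by
      by_contra hne
      obtain ⟨g, hg, hgf⟩ := mem_monIdeal.1 (hb (S f)).1 f (mem_support_iff.2 hne)
      have hgf' := hmin g (hG'G hg) hgf
      rw [Finset.mem_coe, hG', Finset.mem_filter, hgf'] at hg
      exact lt_irrefl _ hg.2.1
    rw [h2, sub_zero] at h1
    exact one_ne_zero h1

end HasLinearQuotients

/-! ### Regularity of ideals with linear quotients -/

/-- Finite-dimensionality makes `finrank` detect nonvanishing Koszul homology. -/
instance finiteDimensional_koszulChains (I : Ideal (MvPolynomial (Fin n) K)) (i j : ℕ) :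
    FiniteDimensional K (koszulChains I i j) := by
  have : Finite {e : Fin n →₀ ℕ // e.degree ≤ j} := Finsupp.finite_of_degree_le j
  let φ : koszulChains I i j →ₗ[K] Finset (Fin n) → {e : Fin n →₀ ℕ // e.degree ≤ j} → K :=
    LinearMap.pi fun T => LinearMap.pi fun e =>
      (lcoeff K e.1).comp ((LinearMap.proj T).comp (koszulChains I i j).subtype)
  refine FiniteDimensional.of_injective φ ((injective_iff_map_eq_zero φ).2 fun c hc => ?_)
  ext T e
  by_contra hne
  have hdeg := ((c.2 T).2 e (mem_support_iff.2 hne)).2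
  exact hne (congrFun (congrFun hc T) ⟨e, by omega⟩)

theorem gradedBetti_ne_zero {I : Ideal (MvPolynomial (Fin n) K)} {i j : ℕ}
    {z : Finset (Fin n) → MvPolynomial (Fin n) K} (hz : z ∈ koszulCycles I i j)
    (hzb : z ∉ koszulBoundaries I i j) : gradedBetti I i j ≠ 0 := by
  have : FiniteDimensional K (koszulCycles I i j) :=
    Submodule.finiteDimensional_of_le (inf_le_left : _ ≤ koszulChains I i j)
  have : Nontrivial (GradedTor I i j) := by
    refine Submodule.Quotient.nontrivial_iff.2 fun htop => hzb ?_
    rw [Submodule.submoduleOf, Submodule.comap_subtype_eq_top] at htop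
    exact htop hz
  exact Module.finrank_pos.ne'

/-- The regularity of an ideal with linear quotients is the largest degree of a generator. -/
theorem HasLinearQuotients.reg_eq {G : Finset (Fin n →₀ ℕ)} {ord : (Fin n →₀ ℕ) → ℕ}
    {S : (Fin n →₀ ℕ) → Finset (Fin n)} (h : HasLinearQuotients G ord S) :
    reg (monIdeal K (G : Set (Fin n →₀ ℕ))) =
      G.sup fun f => ((f.degree : ℕ∞) : WithBot ℕ∞) := by
  apply le_antisymm
  · refine sSup_le ?_
    rintro r ⟨i, j, d, hne, rfl, rfl⟩
    by_contra hlt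
    refine hne ?_
    have hle := h.koszulCycles_le_koszulBoundaries (K := K) (i := i) (j := i + d) fun f hf => by
      by_contra hfd
      refine hlt (le_trans ?_ (Finset.le_sup hf))
      have : d ≤ f.degree := by omega
      exact_mod_cast this
    have : Subsingleton (GradedTor (monIdeal K (G : Set (Fin n →₀ ℕ))) i (i + d)) := by
      rw [GradedTor, Submodule.Quotient.subsingleton_iff, Submodule.submoduleOf,
        Submodule.comap_subtype_eq_top]
      exact hle
    exact Module.finrank_zero_of_subsingleton
  · refine Finset.sup_le fun f hf => le_sSup ⟨(S f).card, _, f.degree, ?_, rfl, rfl⟩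
    obtain ⟨z, hz, hzb⟩ := h.exists_cycle K hf
    refine gradedBetti_ne_zero hz fun hmem => ?_
    obtain ⟨b, hb, he⟩ := hmem
    exact hzb b (fun T => (hb T).1) he

/-! ### Projective dimension of ideals with linear quotients: the upper bound -/

section ProjectiveDimension

open CategoryTheory

universe u

variable {R : Type u} [CommRing R] {A B C : Type u} [AddCommGroup A] [Module R A]
  [AddCommGroup B] [Module R B] [AddCommGroup C] [Module R C] {f : A →ₗ[R] B} {g : B →ₗ[R] C}

theorem shortExact_of_exact (hf : Function.Injective f) (hg : Function.Surjective g)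
    (hfg : Function.Exact f g) :
    (ShortComplex.mk (ModuleCat.ofHom f) (ModuleCat.ofHom g)
      (by ext x; exact hfg.apply_apply_eq_zero x)).ShortExact :=
  ModuleCat.shortComplex_shortExact _ hfg hf hg

theorem hasProjectiveDimensionLT_middle (hf : Function.Injective f) (hg : Function.Surjective g)
    (hfg : Function.Exact f g) (k : ℕ) (hA : HasProjectiveDimensionLT (ModuleCat.of R A) k)
    (hC : HasProjectiveDimensionLT (ModuleCat.of R C) k) :
    HasProjectiveDimensionLT (ModuleCat.of R B) k :=
  (shortExact_of_exact hf hg hfg).hasProjectiveDimensionLT_X₂ k hA hC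

theorem hasProjectiveDimensionLT_right (hf : Function.Injective f) (hg : Function.Surjective g)
    (hfg : Function.Exact f g) (k : ℕ) (hA : HasProjectiveDimensionLT (ModuleCat.of R A) k)
    (hB : HasProjectiveDimensionLT (ModuleCat.of R B) (k + 1)) :
    HasProjectiveDimensionLT (ModuleCat.of R C) (k + 1) :=
  (shortExact_of_exact hf hg hfg).hasProjectiveDimensionLT_X₃ k hA hB

/-- Passing from `R / Q` to `R / (Q + (x))`, with `x` a nonzerodivisor modulo `Q`, raises the
projective dimension by at most one. -/
theorem hasProjectiveDimensionLT_quotient_sup {Q : Ideal R} {x : R}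
    (hx : ∀ p, x * p ∈ Q → p ∈ Q) (k : ℕ)
    (hQ : HasProjectiveDimensionLT (ModuleCat.of R (R ⧸ Q)) k) :
    HasProjectiveDimensionLT (ModuleCat.of R (R ⧸ (Q ⊔ Ideal.span {x}))) (k + 1) := by
  refine hasProjectiveDimensionLT_right
    (f := LinearMap.lsmul R (R ⧸ Q) x) (g := Submodule.factor (le_sup_left : Q ≤ _))
    ?_ (Submodule.factor_surjective _) ?_ k hQ
    (hasProjectiveDimensionLT_of_ge _ k _ (Nat.le_succ k))
  · rw [injective_iff_map_eq_zero]
    intro y hy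
    obtain ⟨p, rfl⟩ := Submodule.Quotient.mk_surjective _ y
    rw [LinearMap.lsmul_apply, ← Submodule.Quotient.mk_smul, Submodule.Quotient.mk_eq_zero] at hy
    exact (Submodule.Quotient.mk_eq_zero _).2 (hx p hy)
  · intro y
    obtain ⟨p, rfl⟩ := Submodule.Quotient.mk_surjective _ y
    have h1 : Submodule.factor (le_sup_left : Q ≤ Q ⊔ Ideal.span {x}) (Submodule.Quotient.mk p) =
        Submodule.Quotient.mk p := rfl
    rw [h1, Submodule.Quotient.mk_eq_zero, Submodule.mem_sup]
    constructor
    · rintro ⟨q, hq, z, hz, rfl⟩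
      obtain ⟨r, rfl⟩ := Ideal.mem_span_singleton'.1 hz
      refine ⟨Submodule.Quotient.mk r, ?_⟩
      rw [LinearMap.lsmul_apply, ← Submodule.Quotient.mk_smul, Submodule.Quotient.eq]
      rw [smul_eq_mul, mul_comm x r, sub_add_cancel_right]
      exact neg_mem hq
    · rintro ⟨y, hy⟩
      obtain ⟨r, rfl⟩ := Submodule.Quotient.mk_surjective _ y
      rw [LinearMap.lsmul_apply, ← Submodule.Quotient.mk_smul, Submodule.Quotient.eq] at hy
      refine ⟨p - x * r, ?_, x * r, Ideal.mul_mem_right _ _ (Ideal.mem_span_singleton_self x),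
        by ring⟩
      have := neg_mem hy
      rwa [smul_eq_mul, neg_sub] at this

/-- If `I = J + (x)` and `J : x = Q`, then `I / J ≅ R / Q`, so `pd I ≤ max (pd J) (pd (R / Q))`. -/
theorem hasProjectiveDimensionLT_sup_span {I J Q : Ideal R} {x : R} (hI : I = J ⊔ Ideal.span {x})
    (hQ : ∀ p, x * p ∈ J ↔ p ∈ Q) (k : ℕ)
    (hJ : HasProjectiveDimensionLT (ModuleCat.of R J) k)
    (hRQ : HasProjectiveDimensionLT (ModuleCat.of R (R ⧸ Q)) k) :
    HasProjectiveDimensionLT (ModuleCat.of R I) k := by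
  have hJI : J ≤ I := hI ▸ le_sup_left
  have hxI : x ∈ I := hI ▸ (le_sup_right : _ ≤ J ⊔ _) (Ideal.mem_span_singleton_self x)
  let φ : R →ₗ[R] (I ⧸ J.submoduleOf I) :=
    (J.submoduleOf I).mkQ.comp (LinearMap.toSpanSingleton R I ⟨x, hxI⟩)
  have hφ : ∀ p, φ p = 0 ↔ p ∈ Q := fun p => by
    rw [← hQ]
    refine (Submodule.Quotient.mk_eq_zero _).trans ?_
    change p * x ∈ J ↔ x * p ∈ J
    rw [mul_comm]
  have hker : LinearMap.ker φ = Q := by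
    ext p
    exact hφ p
  have hsurj : Function.Surjective φ := by
    intro y
    obtain ⟨⟨y, hy⟩, rfl⟩ := Submodule.Quotient.mk_surjective _ y
    have hy' := hy
    rw [hI, Submodule.mem_sup] at hy'
    obtain ⟨a, ha, z, hz, rfl⟩ := hy'
    obtain ⟨r, rfl⟩ := Ideal.mem_span_singleton'.1 hz
    refine ⟨r, (Submodule.Quotient.eq _).2 ?_⟩
    have : ((LinearMap.toSpanSingleton R I ⟨x, hxI⟩ r - ⟨a + r * x, hy⟩ : I) : R) = -a := by
      change r * x - (a + r * x) = -a
      ring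
    change ((LinearMap.toSpanSingleton R I ⟨x, hxI⟩ r - ⟨a + r * x, hy⟩ : I) : R) ∈ J
    rw [this]
    exact neg_mem ha
  have e : (R ⧸ Q) ≃ₗ[R] (I ⧸ J.submoduleOf I) :=
    (Submodule.quotEquivOfEq _ _ hker.symm).trans (φ.quotKerEquivOfSurjective hsurj)
  refine hasProjectiveDimensionLT_middle (f := Submodule.inclusion hJI)
    (g := (J.submoduleOf I).mkQ) (Submodule.inclusion_injective hJI)
    (Submodule.mkQ_surjective _) ?_ k hJ
    (@hasProjectiveDimensionLT_of_iso _ _ _ _ _ e.toModuleIso k hRQ)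
  rw [LinearMap.exact_iff, Submodule.ker_mkQ, Submodule.range_inclusion]
  rfl

end ProjectiveDimension

open CategoryTheory

theorem hasProjectiveDimensionLT_quotient_varIdeal (S : Finset (Fin n)) :
    HasProjectiveDimensionLT
      (ModuleCat.of (MvPolynomial (Fin n) K) (MvPolynomial (Fin n) K ⧸ varIdeal K S))
      (S.card + 1) := by
  induction S using Finset.induction_on with
  | empty =>
    have h0 : varIdeal K (∅ : Finset (Fin n)) = ⊥ := by
      rw [varIdeal, Finset.coe_empty, Set.image_empty, Ideal.span_empty]
    have : Module.Projective (MvPolynomial (Fin n) K)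
        (MvPolynomial (Fin n) K ⧸ varIdeal K (∅ : Finset (Fin n))) :=
      Module.Projective.of_equiv (Submodule.quotEquivOfEqBot _ h0).symm
    rw [Finset.card_empty, zero_add, ← projective_iff_hasProjectiveDimensionLT_one,
      ← IsProjective.iff_projective]
    exact this
  | insert v S hv ih =>
    have h1 : varIdeal K (insert v S) = varIdeal K S ⊔ Ideal.span {X v} := by
      rw [varIdeal, Finset.coe_insert, Set.image_insert_eq, Ideal.span_insert, sup_comm]
      rfl
    rw [h1, Finset.card_insert_of_notMem hv]
    refine hasProjectiveDimensionLT_quotient_sup (fun p hp => mem_varIdeal.2 fun e he => ?_) _ ih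
    obtain ⟨t, ht, h⟩ := mem_varIdeal.1 hp (Finsupp.single v 1 + e) (by
      rw [support_X_mul, Finset.mem_map]
      exact ⟨e, he, rfl⟩)
    have hvt : v ≠ t := fun h => hv (h ▸ ht)
    exact ⟨t, ht, by simpa [hvt] using h⟩

/-- Upper bound for the projective dimension: the last generator `f` contributes the quotient
`R / (x_t : t ∈ S f)`. -/
theorem HasLinearQuotients.hasProjectiveDimensionLT {G : Finset (Fin n →₀ ℕ)}
    {ord : (Fin n →₀ ℕ) → ℕ} {S : (Fin n →₀ ℕ) → Finset (Fin n)}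
    (h : HasLinearQuotients G ord S) {k : ℕ} (hk : ∀ f ∈ G, (S f).card < k) :
    HasProjectiveDimensionLT (ModuleCat.of (MvPolynomial (Fin n) K)
      (monIdeal K (G : Set (Fin n →₀ ℕ)))) k := by
  induction G using Finset.induction_on_max_value ord with
  | empty =>
    have h0 : monIdeal K ((∅ : Finset (Fin n →₀ ℕ)) : Set (Fin n →₀ ℕ)) = ⊥ := by
      rw [monIdeal, Finset.coe_empty, Set.image_empty, Ideal.span_empty]
    have : Subsingleton (monIdeal K ((∅ : Finset (Fin n →₀ ℕ)) : Set (Fin n →₀ ℕ))) :=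
      Submodule.subsingleton_iff_eq_bot.2 h0
    have := (ModuleCat.isZero_of_subsingleton (ModuleCat.of (MvPolynomial (Fin n) K)
      (monIdeal K ((∅ : Finset (Fin n →₀ ℕ)) : Set (Fin n →₀ ℕ))))).hasProjectiveDimensionLT_zero
    exact hasProjectiveDimensionLT_of_ge _ 0 k (Nat.zero_le k)
  | insert f G hf hmax ih =>
    have hI : monIdeal K ((insert f G : Finset (Fin n →₀ ℕ)) : Set (Fin n →₀ ℕ)) =
        monIdeal K (G : Set (Fin n →₀ ℕ)) ⊔ Ideal.span {monomial f 1} := by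
      rw [monIdeal, Finset.coe_insert, Set.image_insert_eq, Ideal.span_insert, sup_comm]
      rfl
    have := hasProjectiveDimensionLT_quotient_varIdeal (K := K) (S f)
    exact hasProjectiveDimensionLT_sup_span hI
      (fun p => monomial_mul_mem_monIdeal (exists_lt_of_insert hf hmax h) (exists_le_of_insert h))
      k (ih (of_insert hf hmax h) fun g hg => hk g (Finset.mem_insert_of_mem hg))
      (hasProjectiveDimensionLT_of_ge _ ((S f).card + 1) k (hk f (Finset.mem_insert_self _ _)))

/-! ### Projective dimension and Koszul homology -/

section KoszulHomology

universe u

variable {K : Type u} [Field K]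

/-- The Koszul complex of `x_1, …, x_n` with coefficients in `M` is exact in homological
degree `i`. -/
def KoszulExactAt (K : Type u) [Field K] {n : ℕ} (M : Type u) [AddCommGroup M]
    [Module (MvPolynomial (Fin n) K) M] (i : ℕ) : Prop :=
  ∀ c : Finset (Fin n) → M, (∀ T, T.card ≠ i → c T = 0) → moduleKoszulDiff (K := K) M c = 0 →
    ∃ b : Finset (Fin n) → M, (∀ T, T.card ≠ i + 1 → b T = 0) ∧ moduleKoszulDiff (K := K) M b = c

theorem koszulExactAt_self {i : ℕ} (hi : i ≠ 0) :
    KoszulExactAt (n := n) K (MvPolynomial (Fin n) K) i := by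
  intro c hc hd
  obtain ⟨b, hb, he⟩ := exists_koszulDiff_eq (p := fun _ => True) hi (g := c)
    (fun T e h => ⟨by
      by_contra hT
      rw [hc T hT] at h
      simp at h, trivial⟩)
    (by rw [koszulDiff_eq, hd])
  refine ⟨b, fun T hT => ?_, by rw [← koszulDiff_eq, he]⟩
  exact support_eq_empty.1 (Finset.eq_empty_of_forall_notMem fun e h => hT (hb T e h).1)

theorem koszulExactAt_finsupp (ι : Type u) {i : ℕ} (hi : i ≠ 0) :
    KoszulExactAt (n := n) K (ι →₀ MvPolynomial (Fin n) K) i := by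
  classical
  intro c hc hd
  have hcomp : ∀ m : ι, ∃ b : Finset (Fin n) → MvPolynomial (Fin n) K,
      (∀ T, T.card ≠ i + 1 → b T = 0) ∧
        moduleKoszulDiff (K := K) (MvPolynomial (Fin n) K) b = fun T => c T m := fun m => by
    refine koszulExactAt_self hi _ (fun T hT => by rw [hc T hT]; rfl) ?_
    have := moduleKoszulDiff_comp (K := K)
      (Finsupp.lapply m : (ι →₀ MvPolynomial (Fin n) K) →ₗ[MvPolynomial (Fin n) K] _) c
    rw [hd] at this
    exact this
  choose b hb hbd using hcomp
  let A : Finset ι := Finset.univ.biUnion fun T => (c T).support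
  refine ⟨∑ m ∈ A, fun T => Finsupp.lsingle (R := MvPolynomial (Fin n) K) m (b m T),
    fun T hT => ?_, ?_⟩
  · rw [Finset.sum_apply]
    exact Finset.sum_eq_zero fun m _ => by rw [hb m T hT, map_zero]
  · rw [map_sum]
    funext T
    rw [Finset.sum_apply]
    simp only [moduleKoszulDiff_comp, hbd]
    ext1 m
    rw [Finsupp.finsetSum_apply]
    simp only [Finsupp.lsingle_apply, Finsupp.single_apply]
    rw [Finset.sum_ite_eq' A m]
    split_ifs with hm
    · rfl
    · by_contra hne
      exact hm (Finset.mem_biUnion.2 ⟨T, Finset.mem_univ _,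
        Finsupp.mem_support_iff.2 (Ne.symm hne)⟩)

theorem koszulExactAt_of_projective {M : Type u} [AddCommGroup M]
    [Module (MvPolynomial (Fin n) K) M] [Module.Projective (MvPolynomial (Fin n) K) M] {i : ℕ}
    (hi : i ≠ 0) : KoszulExactAt (n := n) K M i := by
  intro c hc hd
  obtain ⟨s, hs⟩ := Module.projective_def'.1 (inferInstance :
    Module.Projective (MvPolynomial (Fin n) K) M)
  obtain ⟨b, hb, he⟩ := koszulExactAt_finsupp M hi (fun T => s (c T))
    (fun T hT => by rw [hc T hT, map_zero])
    (by rw [moduleKoszulDiff_comp, hd]; funext T; exact map_zero s)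
  refine ⟨fun T => Finsupp.linearCombination _ id (b T), fun T hT =>
    (congrArg _ (hb T hT)).trans (map_zero _), ?_⟩
  rw [moduleKoszulDiff_comp, he]
  funext T
  exact LinearMap.congr_fun hs (c T)

/-- The Koszul homology of a module of projective dimension less than `d` vanishes from homological
degree `d` on. -/
theorem koszulExactAt_of_hasProjectiveDimensionLT (d : ℕ) (M : Type u) [AddCommGroup M]
    [Module (MvPolynomial (Fin n) K) M]
    (h : HasProjectiveDimensionLT (ModuleCat.of (MvPolynomial (Fin n) K) M) d) {i : ℕ}
    (hi : d ≤ i) : KoszulExactAt (n := n) K M i := by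
  induction d generalizing M i with
  | zero =>
    have : Subsingleton M :=
      ModuleCat.isZero_iff_subsingleton.1
        (isZero_of_hasProjectiveDimensionLT_zero (ModuleCat.of (MvPolynomial (Fin n) K) M))
    exact fun c _ _ => ⟨0, fun _ _ => rfl, Subsingleton.elim _ _⟩
  | succ d ih =>
    obtain rfl | ⟨d, rfl⟩ : d = 0 ∨ ∃ d', d = d' + 1 := by
      cases d <;> simp
    · have : Module.Projective (MvPolynomial (Fin n) K) M := by
        rw [IsProjective.iff_projective]
        exact projective_iff_hasProjectiveDimensionLT_one.2 h
      exact koszulExactAt_of_projective (by omega)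
    · obtain ⟨i, rfl⟩ : ∃ i', i = i' + 1 := ⟨i - 1, by omega⟩
      let π : (M →₀ MvPolynomial (Fin n) K) →ₗ[MvPolynomial (Fin n) K] M :=
        Finsupp.linearCombination _ id
      have hπ : Function.Surjective π := Finsupp.linearCombination_id_surjective _ M
      have hN : HasProjectiveDimensionLT
          (ModuleCat.of (MvPolynomial (Fin n) K) (LinearMap.ker π)) (d + 1) := by
        have hS := LinearMap.shortExact_shortComplexKer hπ
        exact (hS.hasProjectiveDimensionLT_X₃_iff d
          ((IsProjective.iff_projective (R := MvPolynomial (Fin n) K)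
            (M →₀ MvPolynomial (Fin n) K)).1 inferInstance)).1 h
      intro c hc hd
      have hlift : ∀ T, ∃ y : M →₀ MvPolynomial (Fin n) K,
          π y = c T ∧ (c T = 0 → y = 0) := fun T => by
        by_cases h0 : c T = 0
        · exact ⟨0, by rw [h0, map_zero], fun _ => rfl⟩
        · obtain ⟨y, hy⟩ := hπ (c T)
          exact ⟨y, hy, fun h => absurd h h0⟩
      -- A cycle of `M` lifts to a chain of the free module `M →₀ R`, whose boundary lies in the
      -- syzygy module `ker π`.
      choose y hy hy0 using hlift
      have hyc : (fun T => π (y T)) = c := funext hy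
      have hker : ∀ T, moduleKoszulDiff (K := K) (M →₀ MvPolynomial (Fin n) K) y T ∈
          LinearMap.ker π := fun T => by
        have := moduleKoszulDiff_comp (K := K) π y
        rw [hyc, hd] at this
        exact (congrFun this T).symm
      obtain ⟨a, ha, hae⟩ := ih (LinearMap.ker π) hN (i := i) (by omega)
        (fun T => ⟨_, hker T⟩) (fun T hT => by
          ext1
          change moduleKoszulDiff (K := K) (M →₀ MvPolynomial (Fin n) K) y T = 0
          rw [moduleKoszulDiff_apply]
          refine Finset.sum_eq_zero fun v hv => ?_
          rw [hy0 _ (hc _ ?_), smul_zero]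
          rw [Finset.card_insert_of_notMem (by simpa using hv)]
          omega) (by
          have := moduleKoszulDiff_comp (K := K) (LinearMap.ker π).subtype
            (fun T => (⟨_, hker T⟩ : LinearMap.ker π))
          funext T
          ext1
          have h1 := congrFun this T
          have h2 := moduleKoszulDiff_sq (K := K) y
          exact h1.symm.trans (congrFun h2 T))
      have hae' := moduleKoszulDiff_comp (K := K) (LinearMap.ker π).subtype a
      rw [hae] at hae'
      obtain ⟨w, hw, hwe⟩ := koszulExactAt_of_projective (K := K) (n := n)
        (M := M →₀ MvPolynomial (Fin n) K) (i := i + 1) (by omega) (y - fun T => (LinearMap.ker π).subtype (a T))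
        (fun T hT => by
          rw [Pi.sub_apply, hy0 T (hc T hT), ha T hT, map_zero, sub_zero])
        (by rw [map_sub, hae']; exact sub_self _)
      refine ⟨fun T => π (w T), fun T hT => by rw [← map_zero π, ← hw T hT], ?_⟩
      rw [moduleKoszulDiff_comp, hwe]
      funext T
      rw [Pi.sub_apply, map_sub, hy]
      exact (congrArg _ (a T).2).trans (sub_zero _)

end KoszulHomology

/-- Lower bound for the projective dimension: the cycle attached to `f` is a nonzero Koszul homology
class in homological degree `#(S f)`. -/
theorem HasLinearQuotients.card_le_pd {G : Finset (Fin n →₀ ℕ)} {ord : (Fin n →₀ ℕ) → ℕ}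
    {S : (Fin n →₀ ℕ) → Finset (Fin n)} (h : HasLinearQuotients G ord S) {f : Fin n →₀ ℕ}
    (hf : f ∈ G) :
    (((S f).card : ℕ∞) : WithBot ℕ∞) ≤ pd (monIdeal K (G : Set (Fin n →₀ ℕ))) := by
  refine (projectiveDimension_ge_iff _ (S f).card).2 fun hpd => ?_
  obtain ⟨z, ⟨hz, hdz⟩, hzb⟩ := h.exists_cycle K hf
  have hsub := fun c => moduleKoszulDiff_comp (K := K)
    (monIdeal K (G : Set (Fin n →₀ ℕ))).subtype c
  obtain ⟨b, -, he⟩ := koszulExactAt_of_hasProjectiveDimensionLT _ _ hpd le_rfl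
    (fun T => ⟨z T, (hz T).1⟩)
    (fun T hT => by
      ext1
      exact support_eq_empty.1
        (Finset.eq_empty_of_forall_notMem fun e h => hT ((hz T).2 e h).1))
    (by
      funext T
      ext1
      have h1 := congrFun (hsub fun T => ⟨z T, (hz T).1⟩) T
      have h2 := LinearMap.mem_ker.1 hdz
      rw [koszulDiff_eq] at h2
      exact h1.symm.trans (congrFun h2 T))
  refine hzb (fun T => (b T : MvPolynomial (Fin n) K)) (fun T => (b T).2) ?_
  rw [koszulDiff_eq]
  refine (hsub b).trans ?_
  rw [he]
  rfl

/-- The projective dimension of an ideal with linear quotients is the largest number of variables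
attached to a generator. -/
theorem HasLinearQuotients.pd_eq {G : Finset (Fin n →₀ ℕ)} {ord : (Fin n →₀ ℕ) → ℕ}
    {S : (Fin n →₀ ℕ) → Finset (Fin n)} (h : HasLinearQuotients G ord S) :
    pd (monIdeal K (G : Set (Fin n →₀ ℕ))) =
      G.sup fun f => (((S f).card : ℕ∞) : WithBot ℕ∞) := by
  refine le_antisymm ?_ (Finset.sup_le fun f hf => h.card_le_pd hf)
  -- `k` is one more than the maximum, and `0` for the empty family, where the ideal is zero.
  obtain ⟨k, hk⟩ : ∃ k : ℕ, (∀ f ∈ G, (S f).card < k) ∧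
      ((k = 0 ∧ G = ∅) ∨ ∃ f ∈ G, (S f).card + 1 = k) := by
    rcases G.eq_empty_or_nonempty with rfl | hne
    · exact ⟨0, by simp, Or.inl ⟨rfl, rfl⟩⟩
    · obtain ⟨f, hf, hmax⟩ := G.exists_max_image (fun f => (S f).card) hne
      exact ⟨(S f).card + 1, fun g hg => Nat.lt_succ_of_le (hmax g hg), Or.inr ⟨f, hf, rfl⟩⟩
  have hpd := h.hasProjectiveDimensionLT (K := K) hk.1
  rcases hk.2 with ⟨rfl, rfl⟩ | ⟨f, hf, rfl⟩
  · have := (projectiveDimension_eq_bot_iff _).2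
      ((hasProjectiveDimensionLT_zero_iff_isZero _).1 hpd)
    exact (this : pd _ = ⊥).le.trans bot_le
  · refine le_trans ?_ (Finset.le_sup hf)
    exact (projectiveDimension_le_iff _ (S f).card).2 hpd

/-! ### Minimal generators -/

theorem minGens_monIdeal {A : Set (Fin n →₀ ℕ)} (hA : IsAntichain (· ≤ ·) A) :
    minGens (monIdeal K A) = A := by
  ext a
  simp only [minGens, monomial_mem_monIdeal, Set.mem_ofPred_eq]
  constructor
  · rintro ⟨⟨g, hg, hga⟩, hmin⟩
    rwa [le_antisymm (hmin ⟨g, hg, le_rfl⟩ hga) hga]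
  · refine fun ha => ⟨⟨a, ha, le_rfl⟩, ?_⟩
    rintro b ⟨g, hg, hgb⟩ hba
    by_contra hab
    have : g ≠ a := fun h => hab (h ▸ hgb)
    exact hA hg ha this (hgb.trans hba)

theorem isAntichain_minGens (I : Ideal (MvPolynomial (Fin n) K)) :
    IsAntichain (· ≤ ·) (minGens I) :=
  setOfPred_minimal_antichain _

theorem monIdeal_minGens {I : Ideal (MvPolynomial (Fin n) K)} (hI : IsMonomialIdeal I) :
    monIdeal K (minGens I) = I := by
  apply le_antisymm
  · rw [monIdeal, Ideal.span_le]
    rintro _ ⟨a, ha, rfl⟩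
    exact ha.1
  · obtain ⟨A, hA⟩ := hI
    conv_lhs => rw [hA]
    rw [Ideal.span_le]
    rintro _ ⟨a, ha, rfl⟩
    have haI : monomial a (1 : K) ∈ I := by
      rw [hA]
      exact Ideal.subset_span ⟨a, ha, rfl⟩
    obtain ⟨b, hba, hb⟩ := exists_minimal_le_of_wellFoundedLT
      (fun b => monomial b (1 : K) ∈ I) a haI
    exact monomial_mem_monIdeal.2 ⟨b, hb, hba⟩

theorem IsDecomposable.isMonomialIdeal {k : ℤ} {I : Ideal (MvPolynomial (Fin n) K)}
    (h : IsDecomposable k I) : IsMonomialIdeal I := by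
  cases h with
  | of_single _ hI _ => exact hI
  | of_shedding _ hI _ _ _ _ _ => exact hI

theorem minGens_lowerIdeal (I : Ideal (MvPolynomial (Fin n) K)) (u : Fin n →₀ ℕ) :
    minGens (lowerIdeal I u) = {M | M ∈ minGens I ∧ BracketEqOne u M} :=
  minGens_monIdeal ((isAntichain_minGens I).subset fun _ h => h.1)

theorem minGens_upperIdeal (I : Ideal (MvPolynomial (Fin n) K)) (u : Fin n →₀ ℕ) :
    minGens (upperIdeal I u) = {M | M ∈ minGens I ∧ ¬ BracketEqOne u M} :=
  minGens_monIdeal ((isAntichain_minGens I).subset fun _ h => h.1)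

/-! ### Linear quotients from a shedding monomial -/

/-- The order listing the generators of `I^u` first and then those of `I_u`. -/
def shedOrd (G₁ : Finset (Fin n →₀ ℕ)) (ord₁ ord₂ : (Fin n →₀ ℕ) → ℕ) : (Fin n →₀ ℕ) → ℕ :=
  fun g => if g ∈ G₁ then ord₁ g else G₁.sup ord₁ + 1 + ord₂ g

/-- The variables attached to the generators of `I^u` are kept, and those attached to the generators
of `I_u` are enlarged by the support of `u`. -/
def shedVars (G₁ : Finset (Fin n →₀ ℕ)) (u : Fin n →₀ ℕ)
    (S₁ S₂ : (Fin n →₀ ℕ) → Finset (Fin n)) : (Fin n →₀ ℕ) → Finset (Fin n) :=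
  fun g => if g ∈ G₁ then S₁ g else u.support ∪ S₂ g

section Shedding

variable {I : Ideal (MvPolynomial (Fin n) K)} {u : Fin n →₀ ℕ} {G₁ G₂ : Finset (Fin n →₀ ℕ)}
  {ord₁ ord₂ : (Fin n →₀ ℕ) → ℕ} {S₁ S₂ : (Fin n →₀ ℕ) → Finset (Fin n)}

theorem coe_union_eq_minGens (hG₁ : (G₁ : Set (Fin n →₀ ℕ)) = minGens (upperIdeal I u))
    (hG₂ : (G₂ : Set (Fin n →₀ ℕ)) = minGens (lowerIdeal I u)) :
    ((G₁ ∪ G₂ : Finset (Fin n →₀ ℕ)) : Set (Fin n →₀ ℕ)) = minGens I := by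
  rw [Finset.coe_union, hG₁, hG₂, minGens_upperIdeal, minGens_lowerIdeal]
  ext M
  simp only [Set.mem_union, Set.mem_ofPred_eq]
  tauto

theorem exists_le_of_mem_upper (hG₁ : (G₁ : Set (Fin n →₀ ℕ)) = minGens (upperIdeal I u))
    {g : Fin n →₀ ℕ} (hg : g ∈ G₁) : ∃ i ∈ u.support, u i ≤ g i := by
  rw [← Finset.mem_coe, hG₁, minGens_upperIdeal] at hg
  have := hg.2
  rw [BracketEqOne] at this
  push Not at this
  exact this

theorem lt_of_mem_lower (hG₂ : (G₂ : Set (Fin n →₀ ℕ)) = minGens (lowerIdeal I u))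
    {f : Fin n →₀ ℕ} (hf : f ∈ G₂) : ∀ i ∈ u.support, f i < u i := by
  rw [← Finset.mem_coe, hG₂, minGens_lowerIdeal] at hf
  exact fun i hi => not_le.1 (hf.2 i hi)

theorem notMem_upper_of_mem_lower (hG₁ : (G₁ : Set (Fin n →₀ ℕ)) = minGens (upperIdeal I u))
    (hG₂ : (G₂ : Set (Fin n →₀ ℕ)) = minGens (lowerIdeal I u)) {f : Fin n →₀ ℕ} (hf : f ∈ G₂) :
    f ∉ G₁ := fun hf₁ => by
  obtain ⟨i, hi, h⟩ := exists_le_of_mem_upper hG₁ hf₁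
  exact absurd (lt_of_mem_lower hG₂ hf i hi) (not_lt.2 h)

/-- If `I^u` and `I_u` have linear quotients and `u` is a shedding monomial, then `I` has linear
quotients. -/
theorem HasLinearQuotients.shed (hu : IsSheddingMonomial I u)
    (hG₁ : (G₁ : Set (Fin n →₀ ℕ)) = minGens (upperIdeal I u))
    (hG₂ : (G₂ : Set (Fin n →₀ ℕ)) = minGens (lowerIdeal I u))
    (h₁ : HasLinearQuotients G₁ ord₁ S₁) (h₂ : HasLinearQuotients G₂ ord₂ S₂) :
    HasLinearQuotients (G₁ ∪ G₂) (shedOrd G₁ ord₁ ord₂) (shedVars G₁ u S₁ S₂) := by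
  have hn : ∀ {f}, f ∈ G₂ → f ∉ G₁ := fun hf => notMem_upper_of_mem_lower hG₁ hG₂ hf
  have ho₁ : ∀ {f}, f ∈ G₁ → shedOrd G₁ ord₁ ord₂ f = ord₁ f := fun hf => if_pos hf
  have ho₂ : ∀ {f}, f ∈ G₂ → shedOrd G₁ ord₁ ord₂ f = G₁.sup ord₁ + 1 + ord₂ f :=
    fun hf => if_neg (hn hf)
  have hs₁ : ∀ {f}, f ∈ G₁ → shedVars G₁ u S₁ S₂ f = S₁ f := fun hf => if_pos hf
  have hs₂ : ∀ {f}, f ∈ G₂ → shedVars G₁ u S₁ S₂ f = u.support ∪ S₂ f := fun hf => if_neg (hn hf)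
  have hlt : ∀ {g f}, g ∈ G₁ → f ∈ G₂ → shedOrd G₁ ord₁ ord₂ g < shedOrd G₁ ord₁ ord₂ f := by
    intro g f hg hf
    rw [ho₁ hg, ho₂ hf]
    have := Finset.le_sup (f := ord₁) hg
    omega
  constructor
  · rw [coe_union_eq_minGens hG₁ hG₂]
    exact isAntichain_minGens I
  · intro f hf g hg he
    rcases Finset.mem_union.1 hf with hf | hf <;> rcases Finset.mem_union.1 hg with hg | hg
    · exact h₁.injOn hf hg (by rwa [ho₁ hf, ho₁ hg] at he)
    · exact absurd he (hlt hf hg).ne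
    · exact absurd he (hlt hg hf).ne'
    · exact h₂.injOn hf hg (by rw [ho₂ hf, ho₂ hg] at he; omega)
  · intro f hf t ht
    rcases Finset.mem_union.1 hf with hf | hf
    · rw [hs₁ hf] at ht
      obtain ⟨g, hg, hgf, h⟩ := h₁.exists_sub_eq f hf t ht
      exact ⟨g, Finset.mem_union_left _ hg, by rwa [ho₁ hf, ho₁ hg], h⟩
    · rw [hs₂ hf] at ht
      rcases Finset.mem_union.1 ht with ht | ht
      · obtain ⟨g, hg, h⟩ := hu.2 f (hG₂ ▸ hf) t ht
        rw [← hG₁] at hg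
        exact ⟨g, Finset.mem_union_left _ hg, hlt hg hf, h⟩
      · obtain ⟨g, hg, hgf, h⟩ := h₂.exists_sub_eq f hf t ht
        exact ⟨g, Finset.mem_union_right _ hg, by rw [ho₂ hf, ho₂ hg]; omega, h⟩
  · intro f hf g hg hgf
    rcases Finset.mem_union.1 hf with hf | hf <;> rcases Finset.mem_union.1 hg with hg | hg
    · rw [hs₁ hf]
      exact h₁.exists_lt f hf g hg (by rwa [ho₁ hf, ho₁ hg] at hgf)
    · exact absurd hgf (hlt hf hg).not_gt
    · obtain ⟨i, hi, h⟩ := exists_le_of_mem_upper hG₁ hg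
      rw [hs₂ hf]
      exact ⟨i, Finset.mem_union_left _ hi, (lt_of_mem_lower hG₂ hf i hi).trans_le h⟩
    · rw [hs₂ hf]
      obtain ⟨t, ht, h⟩ := h₂.exists_lt f hf g hg (by rw [ho₂ hf, ho₂ hg] at hgf; omega)
      exact ⟨t, Finset.mem_union_right _ ht, h⟩

/-- All generators of `I_u` have exponent `u_l - 1` at each `l ∈ supp u`, so a quotient of two
of them is never such a variable `x_l`. -/
theorem disjoint_support_of_shedding (hu : IsSheddingMonomial I u)
    (hG₁ : (G₁ : Set (Fin n →₀ ℕ)) = minGens (upperIdeal I u))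
    (hG₂ : (G₂ : Set (Fin n →₀ ℕ)) = minGens (lowerIdeal I u))
    (h₂ : HasLinearQuotients G₂ ord₂ S₂) {f : Fin n →₀ ℕ} (hf : f ∈ G₂) :
    Disjoint u.support (S₂ f) := by
  rw [Finset.disjoint_left]
  intro t htu hts
  obtain ⟨g, hg, -, hgf⟩ := h₂.exists_sub_eq f hf t hts
  obtain ⟨N, hN, hNf⟩ := hu.2 f (hG₂ ▸ hf) t htu
  rw [← hG₁] at hN
  obtain ⟨i, hi, hiN⟩ := exists_le_of_mem_upper hG₁ hN
  have h1 := lt_of_mem_lower hG₂ hf i hi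
  have h2 := DFunLike.congr_fun hNf i
  -- `N` exceeds `f` in the coordinate `t` only, so it reaches the exponent `u_t` there.
  have h3 : t = i := by
    by_contra hne
    rw [Finsupp.tsub_apply, Finsupp.single_eq_of_ne' hne] at h2
    omega
  subst h3
  have h4 := DFunLike.congr_fun hgf t
  have h5 := lt_of_mem_lower hG₂ hg t htu
  rw [Finsupp.tsub_apply, Finsupp.single_eq_same] at h2 h4
  omega

end Shedding

/-- Decomposable ideals have linear quotients. -/
theorem IsDecomposable.exists_hasLinearQuotients {k : ℤ} {I : Ideal (MvPolynomial (Fin n) K)}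
    (h : IsDecomposable k I) :
    ∃ (G : Finset (Fin n →₀ ℕ)) (ord : (Fin n →₀ ℕ) → ℕ) (S : (Fin n →₀ ℕ) → Finset (Fin n)),
      (G : Set (Fin n →₀ ℕ)) = minGens I ∧ HasLinearQuotients G ord S := by
  induction h with
  | of_single I hI h =>
    obtain ⟨f, hf⟩ := Set.ncard_eq_one.1 h
    refine ⟨{f}, fun _ => 0, fun _ => ∅, by rw [hf, Finset.coe_singleton], ?_, ?_, ?_, ?_⟩
    · rw [Finset.coe_singleton]
      exact Set.subsingleton_singleton.isAntichain _
    · rw [Finset.coe_singleton]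
      exact Set.injOn_singleton _ _
    · simp
    · simp
  | of_shedding I _ u hu _ _ _ ih₂ ih₁ =>
    obtain ⟨G₁, ord₁, S₁, hG₁, h₁⟩ := ih₁
    obtain ⟨G₂, ord₂, S₂, hG₂, h₂⟩ := ih₂
    exact ⟨G₁ ∪ G₂, _, _, coe_union_eq_minGens hG₁ hG₂, h₁.shed hu hG₁ hG₂ h₂⟩

end

end KDecomp

theorem corollary2p5 {K : Type*} [Field K] {n : ℕ} (k : ℤ)
    (I : Ideal (MvPolynomial (Fin n) K)) (u : Fin n →₀ ℕ)
    (hI : KDecomp.IsDecomposable k I)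
    (hu : KDecomp.IsSheddingMonomial I u)
    (hk : (u.support.card : ℤ) ≤ k + 1)
    (hlower : KDecomp.IsDecomposable k (KDecomp.lowerIdeal I u))
    (hupper : KDecomp.IsDecomposable k (KDecomp.upperIdeal I u)) :
    KDecomp.pd I =
        max (KDecomp.pd (KDecomp.upperIdeal I u))
          (KDecomp.pd (KDecomp.lowerIdeal I u) + (u.support.card : WithBot ℕ∞)) ∧
      KDecomp.reg I =
        max (KDecomp.reg (KDecomp.upperIdeal I u)) (KDecomp.reg (KDecomp.lowerIdeal I u)) := by
  obtain ⟨G₁, ord₁, S₁, hG₁, h₁⟩ := hupper.exists_hasLinearQuotients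
  obtain ⟨G₂, ord₂, S₂, hG₂, h₂⟩ := hlower.exists_hasLinearQuotients
  have h := h₁.shed hu hG₁ hG₂ h₂
  have hpd := h.pd_eq (K := K)
  have hpd₁ := h₁.pd_eq (K := K)
  have hpd₂ := h₂.pd_eq (K := K)
  have hreg := h.reg_eq (K := K)
  have hreg₁ := h₁.reg_eq (K := K)
  have hreg₂ := h₂.reg_eq (K := K)
  rw [KDecomp.coe_union_eq_minGens hG₁ hG₂, KDecomp.monIdeal_minGens hI.isMonomialIdeal] at hpd hreg
  rw [hG₁, KDecomp.monIdeal_minGens hupper.isMonomialIdeal] at hpd₁ hreg₁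
  rw [hG₂, KDecomp.monIdeal_minGens hlower.isMonomialIdeal] at hpd₂ hreg₂
  refine ⟨?_, by rw [hreg, hreg₁, hreg₂, Finset.sup_union]⟩
  rw [hpd, hpd₁, hpd₂, Finset.sup_union]
  congr 1
  · refine Finset.sup_congr rfl fun f hf => ?_
    rw [KDecomp.shedVars, if_pos hf]
  -- Adding `m` commutes with the maximum, also over the empty family since `⊥ + m = ⊥`.
  · rw [Finset.apply_sup_eq_sup_comp (fun x : WithBot ℕ∞ => x + (u.support.card : WithBot ℕ∞))
      (fun x y => (max_add_add_right x y _).symm) (WithBot.bot_add _)]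
    refine Finset.sup_congr rfl fun f hf => ?_
    rw [KDecomp.shedVars, if_neg (KDecomp.notMem_upper_of_mem_lower hG₁ hG₂ hf),
      Finset.card_union_of_disjoint
      (KDecomp.disjoint_support_of_shedding hu hG₁ hG₂ h₂ hf), add_comm]
    push_cast
    rfl
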